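/- **Setting.** A network consists of sources $S_1,\dots,S_N$, parties $A_1,\dots,A_M$ and an adjacency matrix $E\in\{0,1\}^{N\times M}$, where $E_{ij}=1$ means that $S_i$ sends a system to $A_j$. Assume that every source is bipartite (connected to exactly two parties) and that no source is redundant: for $i\neq i'$ the set of parties connected to $S_i$ is not contained in the set of parties connected to $S_{i'}$ (so the network is a simple graph whose vertices are the parties and whose edges are the sources). A quantum model on the network with finite outcome sets $X_j$ consists of finite-dimensional Hilbert spaces $Q_j^{(i)}$ for $E_{ij}=1$, density operators $\rho^{(i)}$ on $\bigotimes_{j|E_{ij}=1}Q_j^{(i)}$, and POVMs $\{M_j^{a}\}_{a\in X_j}$ on $\bigotimes_{i|E_{ij}=1}Q_j^{(i)}$; it produces the distribution $P(a_1,\dots,a_M)=\operatorname{tr}\big[\big(\bigotimes_i\rho^{(i)}\big)\big(\bigotimes_j M_j^{a_j}\big)\big]$. A measurement $\{M^a\}_{a\in O\cup\{\varnothing\}}$ on $\bigotimes_i H_i$, with failure outcome $\varnothing$, is *fair-sampling* if there are trace-non-increasing completely positive maps $\mathcal T_i$ on the operators on $H_i$ (local filters) and a POVM $\{\widetilde M^a\}_{a\in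 O}$ on $\bigotimes_i H_i$ with $M^a=\big(\bigotimes_i\mathcal T_i\big)^*[\widetilde M^a]$ for all $a\in O$ and $M^\varnothing=\mathbb 1-\sum_{a\in O}M^a$, where $^*$ denotes the adjoint map. **Statement.** Consider a quantum model on such a network with outcomes $a_j\in O_j^{\checkmark}\cup\{\varnothing\}$, $O_j^{\checkmark}$ finite, and let $P$ be its distribution. Suppose that $\mathbb P[a_1,\dots,a_M\neq\varnothing]>0$ and that $P$ saturates the Finner inequality: $$\mathbb P[a_1,\dots,a_M\neq\varnothing]=\sqrt{\prod_{j=1}^M\mathbb P[a_j\neq\varnothing]}.$$ Then: 1. Every measurement is fair-sampling on the Hilbert space where the states are supported: for each party $A_j$, the compression of $\{M_j^{a}\}_{a\in O_j^{\checkmark}\cup\{\varnothing\}}$ to $\bigotimes_{i|E_{ij}=1}\operatorname{supp}\rho_{Q_j^{(i)}}$ is fair-sampling, where $\rho_{Q_j^{(i)}}$ is the reduced state of $\rho^{(i)}$ on $Q_j^{(i)}$. 2. The post-selected distribution $\widetilde P(a_1,\dots,a_M)=P(a_1,\dots,a_M\mid a_1,\dots,a_M\neq\varnothing)$, $a_j\in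 O_j^{\checkmark}$, admits a quantum model on the same network; that is, discarding the failures opens no detection loophole. -/

import Mathlib

/-! Finite-dimensional quantum systems are described in a fixed orthonormal basis: an operator on a
system with basis `n` is a matrix `Matrix n n ℂ`, and the tensor product of a family of systems with
bases `κ i` has the basis `∀ i, κ i`. -/

noncomputable section

open scoped ComplexOrder

namespace QNet

section Operators

variable {ι : Type*} [Fintype ι] {κ μ : ι → Type*}

/-- The tensor product `⨂ i, A i` of a family of operators. -/
def tensorMatrix (A : ∀ i, Matrix (κ i) (μ i) ℂ) : Matrix (∀ i, κ i) (∀ i, μ i) ℂ :=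
  Matrix.of fun x y => ∏ i, A i (x i) (y i)

/-- The tensor product `⨂ i, T i` of a family of linear maps on operators: the linear map sending
the matrix unit `|x⟩⟨y| = ⨂ i, |x i⟩⟨y i|` to `⨂ i, T i (|x i⟩⟨y i|)`. -/
def tensorMap [DecidableEq ι] [∀ i, Fintype (κ i)] [∀ i, DecidableEq (κ i)]
    (T : ∀ i, Matrix (κ i) (κ i) ℂ →ₗ[ℂ] Matrix (κ i) (κ i) ℂ) :
    Matrix (∀ i, κ i) (∀ i, κ i) ℂ →ₗ[ℂ] Matrix (∀ i, κ i) (∀ i, κ i) ℂ :=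
  ∑ x : (∀ i, κ i), ∑ y : (∀ i, κ i),
    (Matrix.entryLinearMap ℂ ℂ x y).smulRight
      (tensorMatrix fun i => T i (Matrix.single (x i) (y i) 1))

variable {n : Type*} [Fintype n] [DecidableEq n]

/-- The adjoint `Φ*` of a map `Φ` on operators, characterized by
`tr (Φ(X) Y) = tr (X Φ*(Y))`, see `trace_mul_adjointMap`. -/
def adjointMap (Φ : Matrix n n ℂ →ₗ[ℂ] Matrix n n ℂ) (Y : Matrix n n ℂ) : Matrix n n ℂ :=
  Matrix.of fun b a => (Φ (Matrix.single a b 1) * Y).trace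

theorem trace_mul_adjointMap (Φ : Matrix n n ℂ →ₗ[ℂ] Matrix n n ℂ) (X Y : Matrix n n ℂ) :
    (X * adjointMap Φ Y).trace = (Φ X * Y).trace := by
  conv_rhs => rw [Matrix.matrix_eq_sum_single X]
  simp only [Matrix.trace, Matrix.diag, Matrix.mul_apply, adjointMap, Matrix.of_apply, map_sum,
    Matrix.sum_apply, Finset.sum_mul, Finset.mul_sum]
  have h : ∀ i j, Φ (Matrix.single i j (X i j)) = X i j • Φ (Matrix.single i j 1) := by
    intro i j
    rw [← map_smul]
    simp [Matrix.smul_single]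
  simp only [h, Matrix.smul_apply, smul_eq_mul, mul_assoc]
  symm
  rw [Finset.sum_congr rfl fun _ _ => Finset.sum_comm, Finset.sum_comm]
  refine Finset.sum_congr rfl fun i _ => ?_
  rw [Finset.sum_congr rfl fun _ _ => Finset.sum_comm, Finset.sum_comm]

/-- Complete positivity: `Φ ⊗ id_k` preserves positive semidefiniteness for every `k`. -/
def IsCompletelyPositive (Φ : Matrix n n ℂ →ₗ[ℂ] Matrix n n ℂ) : Prop :=
  ∀ (k : ℕ) (X : Matrix (n × Fin k) (n × Fin k) ℂ), X.PosSemidef →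
    (Matrix.of fun p q : n × Fin k =>
      Φ (Matrix.of fun a b => X (a, p.2) (b, q.2)) p.1 q.1).PosSemidef

/-- A filter: a completely positive map which does not increase the trace of positive semidefinite
operators (the trace of the output is the probability of a successful filtering). -/
structure IsFilter (Φ : Matrix n n ℂ →ₗ[ℂ] Matrix n n ℂ) : Prop where
  completelyPositive : IsCompletelyPositive Φ
  trace_le : ∀ X : Matrix n n ℂ, X.PosSemidef → (Φ X).trace.re ≤ X.trace.re

/-- A density operator. -/
structure IsDensity (ρ : Matrix n n ℂ) : Prop where
  posSemidef : ρ.PosSemidef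
  trace_eq_one : ρ.trace = 1

/-- A POVM with outcome set `O`. -/
structure IsPOVM {O : Type*} [Fintype O] (F : O → Matrix n n ℂ) : Prop where
  posSemidef : ∀ a, (F a).PosSemidef
  sum_eq_one : ∑ a, F a = 1

/-- The measurement `F` on the tensor product of the systems `κ i`, with conclusive outcomes `some a`
and failure outcome `none`, is fair-sampling: there are local filters `T i` on the systems and a
POVM `G` with conclusive outcomes only such that `F` amounts to applying the filters, reporting a
failure unless all of them succeed, and then measuring `G`. -/
def IsFairSampling [DecidableEq ι] [∀ i, Fintype (κ i)] [∀ i, DecidableEq (κ i)]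
    {O : Type*} [Fintype O] (F : Option O → Matrix (∀ i, κ i) (∀ i, κ i) ℂ) : Prop :=
  ∃ (T : ∀ i, Matrix (κ i) (κ i) ℂ →ₗ[ℂ] Matrix (κ i) (κ i) ℂ)
    (G : O → Matrix (∀ i, κ i) (∀ i, κ i) ℂ),
    (∀ i, IsFilter (T i)) ∧ IsPOVM G ∧
    (∀ a : O, F (some a) = adjointMap (tensorMap T) (G a)) ∧
    F none = 1 - ∑ a : O, F (some a)

/-- The columns of `V` form an orthonormal basis of the support (the range) of `ρ`. -/
structure IsSupportBasis {r : ℕ} (ρ : Matrix n n ℂ) (V : Matrix n (Fin r) ℂ) : Prop where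
  isometry : V.conjTranspose * V = 1
  range_eq : LinearMap.range V.mulVecLin = LinearMap.range ρ.mulVecLin

end Operators

section Networks

/-! A network with sources `i : Fin N` and parties `j : Fin M` is given by its adjacency matrix
`E`: the source `i` is connected to the party `j` iff `E i j = true`. -/

variable {N M : ℕ}

/-- Every source is connected to exactly two parties. -/
def IsBipartite (E : Fin N → Fin M → Bool) : Prop :=
  ∀ i, Fintype.card {j // E i j} = 2

/-- No source is redundant: the set of parties connected to a source is never contained in the set
of parties connected to another one. -/
def NoRedundantSource (E : Fin N → Fin M → Bool) : Prop :=
  ∀ i i', i ≠ i' → ¬ ∀ j, E i j → E i' j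

/-- A quantum model on the network `E` in which party `j` has the outcome set `O j`. Whenever source
`i` is connected to party `j`, it sends to it a system of dimension `dim i j` (the values of `dim`
at pairs which are not connected play no role). -/
structure QuantumModel (E : Fin N → Fin M → Bool) (O : Fin M → Type*) [∀ j, Fintype (O j)] where
  dim : Fin N → Fin M → ℕ
  /-- the state prepared by each source, on all the systems that it sends -/
  state : ∀ i, Matrix (∀ j : {j // E i j}, Fin (dim i j)) (∀ j : {j // E i j}, Fin (dim i j)) ℂ
  /-- the measurement of each party, on all the systems that it receives -/
  meas : ∀ j, O j →
    Matrix (∀ i : {i // E i j}, Fin (dim i j)) (∀ i : {i // E i j}, Fin (dim i j)) ℂ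
  isDensity : ∀ i, IsDensity (state i)
  isPOVM : ∀ j, IsPOVM (meas j)

namespace QuantumModel

variable {E : Fin N → Fin M → Bool} {O : Fin M → Type*} [∀ j, Fintype (O j)]

/-- The basis of the tensor product of all the systems of the network. -/
abbrev GlobalBasis (m : QuantumModel E O) : Type :=
  ∀ e : {e : Fin N × Fin M // E e.1 e.2}, Fin (m.dim e.1.1 e.1.2)

/-- The state `⨂ i, ρ i` of all the sources; each `ρ i` acts on the systems sent by source `i`. -/
def globalState (m : QuantumModel E O) : Matrix m.GlobalBasis m.GlobalBasis ℂ :=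
  Matrix.of fun x y => ∏ i,
    m.state i (fun j => x ⟨(i, j.1), j.2⟩) (fun j => y ⟨(i, j.1), j.2⟩)

/-- The operator `⨂ j, M_j^{a j}`; each `M_j` acts on the systems received by party `j`. -/
def globalEffect (m : QuantumModel E O) (a : ∀ j, O j) :
    Matrix m.GlobalBasis m.GlobalBasis ℂ :=
  Matrix.of fun x y => ∏ j,
    m.meas j (a j) (fun i => x ⟨(i.1, j), i.2⟩) (fun i => y ⟨(i.1, j), i.2⟩)

/-- The distribution of the outcomes, by the Born rule. -/
def prob (m : QuantumModel E O) (a : ∀ j, O j) : ℝ :=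
  (m.globalState * m.globalEffect a).trace.re

/-- The reduced state (partial trace of the state of source `i`) of the system sent by source `i` to
party `j`. -/
def reducedState (m : QuantumModel E O) (i : Fin N) (j : {j // E i j}) :
    Matrix (Fin (m.dim i j)) (Fin (m.dim i j)) ℂ :=
  Matrix.of fun s t => ∑ z : (∀ k : {k // E i k}, Fin (m.dim i k)),
    if z j = s then m.state i z (Function.update z j t) else 0

end QuantumModel

variable {E : Fin N → Fin M → Bool} {O : Fin M → Type*} [∀ j, Fintype (O j)]

/-- The measurement of party `j`, restricted to the Hilbert space on which the states are supported,
is fair-sampling. Each received system is restricted to the support of its reduced state, which is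
identified with `ℂ^(r i)` through an orthonormal basis `V i` of the support. -/
def QuantumModel.IsFairSamplingOnSupport (m : QuantumModel E (fun j => Option (O j)))
    (j : Fin M) : Prop :=
  ∀ (r : {i // E i j} → ℕ) (V : ∀ i : {i // E i j}, Matrix (Fin (m.dim i j)) (Fin (r i)) ℂ),
    (∀ i, IsSupportBasis (m.reducedState i.1 ⟨j, i.2⟩) (V i)) →
    IsFairSampling fun a =>
      (tensorMatrix V).conjTranspose * m.meas j a * tensorMatrix V

/-- The distributions of outcomes that admit a quantum model on the network `E`. -/
def quantumCorrelations (E : Fin N → Fin M → Bool) (O : Fin M → Type*) [∀ j, Fintype (O j)] :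
    Set ((∀ j, O j) → ℝ) :=
  {P | ∃ m : QuantumModel E O, m.prob = P}

/-- The probability that party `j` has a conclusive outcome. -/
def probConclusive (P : (∀ j, Option (O j)) → ℝ) (j : Fin M) : ℝ :=
  ∑ a, if (a j).isSome then P a else 0

/-- The probability that all parties have a conclusive outcome. -/
def probAllConclusive (P : (∀ j, Option (O j)) → ℝ) : ℝ :=
  ∑ a, if ∀ j, (a j).isSome then P a else 0

/-- Equality in the Finner inequality. -/
def SaturatesFinner (P : (∀ j, Option (O j)) → ℝ) : Prop :=
  probAllConclusive P = Real.sqrt (∏ j, probConclusive P j)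

/-- The distribution conditioned on all outcomes being conclusive. -/
def postSelected (P : (∀ j, Option (O j)) → ℝ) (a : ∀ j, O j) : ℝ :=
  P (fun j => some (a j)) / probAllConclusive P

end Networks

end QNet

end

noncomputable section

open scoped ComplexOrder

set_option linter.unusedSectionVars false

namespace QNet

/-! ### The classical Finner inequality with exponents `1/2` and its equality case. -/

section Finner

variable {ι : Type*} [Fintype ι] [DecidableEq ι] {α : ι → Type*} [∀ i, Fintype (α i)]
  {F : Type*} [AddCommGroup F] [Module ℝ F]

/-! The quantum statement is reduced to the equality case of the classical Finner inequality. Fix a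
party `j₀`. Purify every source and take a Schmidt decomposition between its two parties, with the
purifying system of each source of `j₀` held by the other party (`exists_isSchmidt`). Let `v i` be
the Schmidt weights and `F j` the conclusive effect of party `j` compressed to the Schmidt vectors,
so that `0 ≤ F j ≤ 1`. With one pair `(s, t)` of ket and bra Schmidt indices per source, the
probability that all outcomes are conclusive is the sum of `∏ √(v s) √(v t)` times `∏ F j (t, s)`
(`born_eq_sum_compress`), while the marginal of party `j` is the diagonal sum of `L s * F j (s, s)`,
where `L` is the product of the weights at `j` (`re_born_marginal`).

Give each pair `(s, t)` the probability `v s * v t`. Since every source has exactly two ends, the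
remaining factor can be shared equally between them, and the first probability becomes the
expectation of a product of functions `k j`, each depending only on the sources of `j`. Finner's
inequality bounds it by the product of the L² norms of the `k j`. Moreover the square of the norm of
`k j`, which is `∑ √(L t) √(L s) |F j (t, s)|²`, is at most `∑ L s (F j * F j) (s, s)` by the
inequality between arithmetic and geometric means, hence at most the marginal because `F j * F j ≤ F
j`. Saturation makes all these steps equalities (`factor_of_schmidt_network`).

Equality in the last step makes `F j` a projection, as the Schmidt weights are strictly positive.
Equality in Finner's inequality gives equality in Cauchy–Schwarz at each source. Two parties share
at most one source, so this makes `k j`, and with it `F j`, a product across each source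
(`exists_factor_of_finner_eq`). A nonzero projection of this kind is a tensor product of projections
(`exists_projections_of_factor`).

At `j₀` the Schmidt vectors span the supports of the received systems, so the conclusive effect is a
product of local projections there. These projections are the filters. Effects that add up to a
projection come from a POVM measured after projecting (`exists_povm_of_sum_eq_projection`), which
gives fair sampling. For the post-selected distribution, the sources apply the projections
themselves; the total success probability is a product over the sources, so each filtered state can
be normalized on its own. -/

/-- The expectation of `f` for independent coordinates with weights `w i`. -/
def expect (w : ∀ i, α i → ℝ) (f : (∀ i, α i) → F) : F :=
  ∑ a, (∏ i, w i (a i)) • f a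

/-- The conditional expectation of `f` obtained by averaging over the coordinate `i`. -/
def condExpect (w : ∀ i, α i → ℝ) (i : ι) (f : (∀ i, α i) → F) (a : ∀ i, α i) : F :=
  ∑ x, w i x • f (Function.update a i x)

theorem dependsOn_update {β : Type*} {f : (∀ i, α i) → β} {s : Set ι} (hf : DependsOn f s) {i : ι}
    (hi : i ∉ s) (a : ∀ i, α i) (x : α i) : f (Function.update a i x) = f a := by
  refine hf fun j hj => ?_
  rw [Function.update_of_ne]
  rintro rfl
  exact hi hj

/-- Resampling the coordinate `i` preserves the product weight: exchanging the old and the new value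
is a weight-preserving involution. -/
theorem expect_condExpect {w : ∀ i, α i → ℝ} (hw : ∀ i, ∑ x, w i x = 1) (i : ι)
    (f : (∀ i, α i) → F) : expect w (condExpect w i f) = expect w f := by
  have key : ∀ (a : ∀ i, α i) (x : α i), (∏ l, w l (a l)) * w i x =
      (∏ l, w l (Function.update a i x l)) * w i (a i) := by
    intro a x
    rw [← Finset.mul_prod_erase _ _ (Finset.mem_univ i),
      ← Finset.mul_prod_erase _ (fun l => w l (Function.update a i x l)) (Finset.mem_univ i)]
    have : ∏ l ∈ Finset.univ.erase i, w l (Function.update a i x l)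
        = ∏ l ∈ Finset.univ.erase i, w l (a l) := by
      refine Finset.prod_congr rfl fun l hl => ?_
      rw [Function.update_of_ne (Finset.ne_of_mem_erase hl)]
    rw [this, Function.update_self]
    ring
  have h1 : expect w (condExpect w i f) = ∑ q : (∀ i, α i) × α i,
      ((∏ l, w l (Function.update q.1 i q.2 l)) * w i (q.1 i)) • f (Function.update q.1 i q.2) := by
    rw [Fintype.sum_prod_type]
    simp only [expect, condExpect, Finset.smul_sum, smul_smul]
    exact Finset.sum_congr rfl fun a _ => Finset.sum_congr rfl fun x _ => by rw [key]
  have h2 : expect w f = ∑ q : (∀ i, α i) × α i, ((∏ l, w l (q.1 l)) * w i q.2) • f q.1 := by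
    rw [Fintype.sum_prod_type]
    refine Finset.sum_congr rfl fun a _ => ?_
    dsimp only
    rw [← Finset.sum_smul, ← Finset.mul_sum, hw, mul_one]
  rw [h1, h2]
  let e : Equiv.Perm ((∀ i, α i) × α i) := Function.Involutive.toPerm
    (fun q => (Function.update q.1 i q.2, q.1 i)) (fun q => by simp)
  exact Fintype.sum_equiv e _ _ fun q => rfl

theorem condExpect_of_dependsOn {w : ∀ i, α i → ℝ} (hw : ∀ i, ∑ x, w i x = 1) {i : ι}
    {f : (∀ i, α i) → F} {s : Set ι} (hf : DependsOn f s) (hi : i ∉ s) : condExpect w i f = f := by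
  funext a
  simp only [condExpect, dependsOn_update hf hi, ← Finset.sum_smul, hw, one_smul]

theorem dependsOn_condExpect {w : ∀ i, α i → ℝ} {i : ι} {f : (∀ i, α i) → F} {s : Set ι}
    (hf : DependsOn f s) : DependsOn (condExpect w i f) (s \ {i}) := by
  intro a b hab
  refine Finset.sum_congr rfl fun x _ => ?_
  congr 1
  refine hf fun j hj => ?_
  by_cases hji : j = i
  · subst hji; simp
  · rw [Function.update_of_ne hji, Function.update_of_ne hji]
    exact hab j ⟨hj, hji⟩

theorem expect_const {w : ∀ i, α i → ℝ} (hw : ∀ i, ∑ x, w i x = 1) (c : F) :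
    expect w (fun _ => c) = c := by
  classical
  rw [expect, ← Finset.sum_smul, ← Fintype.piFinset_univ, ← Finset.prod_univ_sum]
  simp [hw]

theorem expect_mono {w : ∀ i, α i → ℝ} (hw : ∀ i x, 0 ≤ w i x) {f g : (∀ i, α i) → ℝ}
    (h : ∀ a, f a ≤ g a) : expect w f ≤ expect w g :=
  Finset.sum_le_sum fun a _ =>
    smul_le_smul_of_nonneg_left (h a) (Finset.prod_nonneg fun i _ => hw i _)

theorem expect_nonneg {w : ∀ i, α i → ℝ} (hw : ∀ i x, 0 ≤ w i x) {f : (∀ i, α i) → ℝ}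
    (h : ∀ a, 0 ≤ f a) : 0 ≤ expect w f :=
  Finset.sum_nonneg fun a _ => smul_nonneg (Finset.prod_nonneg fun i _ => hw i _) (h a)

theorem eq_of_expect_eq {w : ∀ i, α i → ℝ} (hw : ∀ i x, 0 < w i x) {f g : (∀ i, α i) → ℝ}
    (h : ∀ a, f a ≤ g a) (he : expect w f = expect w g) (a : ∀ i, α i) : f a = g a := by
  have hW : ∀ a : (∀ i, α i), 0 < ∏ i, w i (a i) := fun a => Finset.prod_pos fun i _ => hw i _
  have := (Finset.sum_eq_sum_iff_of_le (s := Finset.univ)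
    (f := fun a => (∏ i, w i (a i)) • f a) (g := fun a => (∏ i, w i (a i)) • g a)
    fun a _ => smul_le_smul_of_nonneg_left (h a) (hW a).le).1 he a (Finset.mem_univ a)
  exact mul_left_cancel₀ (hW a).ne' this

/-- Functions of disjoint sets of coordinates are independent. -/
theorem expect_mul_of_disjoint {w : ∀ i, α i → ℝ} (hw : ∀ i, ∑ x, w i x = 1)
    {f g : (∀ i, α i) → ℝ} {s t : Set ι} (hf : DependsOn f s) (hg : DependsOn g t)
    (hst : Disjoint s t) : expect w (fun a => f a * g a) = expect w f * expect w g := by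
  classical
  -- Two independent copies exchange their coordinates outside `s`. This preserves the weight, does
  -- not affect `f` on the first copy, and lets `g` read the other copy.
  let e : Equiv.Perm ((∀ i, α i) × (∀ i, α i)) := Function.Involutive.toPerm
    (fun q => (s.piecewise q.1 q.2, s.piecewise q.2 q.1)) (fun q => by
      ext i
      all_goals by_cases hi : i ∈ s <;> simp [Set.piecewise, hi])
  have h1 : expect w (fun a => f a * g a) = ∑ q : (∀ i, α i) × (∀ i, α i),
      ((∏ i, w i (q.1 i)) * (∏ i, w i (q.2 i))) * (f q.1 * g q.1) := by
    have h := expect_const hw (1 : ℝ)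
    simp only [expect, smul_eq_mul, mul_one] at h
    rw [Fintype.sum_prod_type]
    refine Finset.sum_congr rfl fun a _ => ?_
    dsimp only
    rw [← Finset.sum_mul, ← Finset.mul_sum, h, mul_one, smul_eq_mul]
  have h2 : expect w f * expect w g = ∑ q : (∀ i, α i) × (∀ i, α i),
      ((∏ i, w i (q.1 i)) * (∏ i, w i (q.2 i))) * (f q.1 * g q.2) := by
    rw [Fintype.sum_prod_type, expect, expect, Finset.sum_mul_sum]
    refine Finset.sum_congr rfl fun a _ => Finset.sum_congr rfl fun b _ => ?_
    simp only [smul_eq_mul]; ring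
  rw [h1, h2]
  symm
  refine Fintype.sum_equiv e _ _ fun q => ?_
  have e1 : (e q).1 = s.piecewise q.1 q.2 := rfl
  have e2 : (e q).2 = s.piecewise q.2 q.1 := rfl
  rw [e1, e2]
  congr 1
  · rw [← Finset.prod_mul_distrib, ← Finset.prod_mul_distrib]
    refine Finset.prod_congr rfl fun i _ => ?_
    by_cases hi : i ∈ s <;> simp [Set.piecewise, hi, mul_comm]
  · congr 1
    · exact hf fun i hi => by simp [Set.piecewise, hi]
    · exact hg fun i hi => by simp [Set.piecewise, Set.disjoint_right.1 hst hi]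

variable {V : Type*} [Fintype V] [DecidableEq V]

theorem sum_mul_sqrt_mul_sqrt_le {X : Type*} [Fintype X] {w f g : X → ℝ} (hw : ∀ x, 0 ≤ w x)
    (hf : ∀ x, 0 ≤ f x) (hg : ∀ x, 0 ≤ g x) :
    ∑ x, w x * (√(f x) * √(g x)) ≤ √(∑ x, w x * f x) * √(∑ x, w x * g x) := by
  have := Real.sum_sqrt_mul_sqrt_le Finset.univ (f := fun x => w x * f x)
    (g := fun x => w x * g x) (fun x => mul_nonneg (hw x) (hf x))
    (fun x => mul_nonneg (hw x) (hg x))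
  refine le_trans (le_of_eq ?_) this
  refine Finset.sum_congr rfl fun x _ => ?_
  rw [Real.sqrt_mul (hw x), Real.sqrt_mul (hw x)]
  calc _ = (√(w x) * √(w x)) * (√(f x) * √(g x)) := by rw [Real.mul_self_sqrt (hw x)]
    _ = _ := by ring

theorem prod_eq_mul_mul_prod_erase {R : Type*} [CommMonoid R] {v₁ v₂ : V} (hne : v₁ ≠ v₂)
    (h : V → R) :
    ∏ v, h v = (h v₁ * h v₂) * ∏ v ∈ (Finset.univ.erase v₁).erase v₂, h v := by
  rw [mul_assoc, Finset.mul_prod_erase _ _ (by simp [hne.symm]),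
    Finset.mul_prod_erase _ _ (Finset.mem_univ _)]

/-- One Cauchy–Schwarz step: averaging over a coordinate that matters for at most two factors. -/
theorem condExpect_prod_sqrt_le {w : ∀ i, α i → ℝ} (hw0 : ∀ i x, 0 ≤ w i x)
    (hw : ∀ i, ∑ x, w i x = 1) {g : V → (∀ i, α i) → ℝ} (hg : ∀ v a, 0 ≤ g v a) {s : V → Set ι}
    (hs : ∀ v, DependsOn (g v) (s v)) {i : ι} {v₁ v₂ : V} (hne : v₁ ≠ v₂)
    (hi : ∀ v, i ∈ s v → v = v₁ ∨ v = v₂) (a : ∀ i, α i) :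
    condExpect w i (fun a => ∏ v, √(g v a)) a ≤ ∏ v, √(condExpect w i (g v) a) := by
  have split := prod_eq_mul_mul_prod_erase (R := ℝ) hne
  have rest : ∀ x, ∏ v ∈ (Finset.univ.erase v₁).erase v₂, √(g v (Function.update a i x))
      = ∏ v ∈ (Finset.univ.erase v₁).erase v₂, √(condExpect w i (g v) a) := by
    intro x
    refine Finset.prod_congr rfl fun v hv => ?_
    have hv' : i ∉ s v := fun h => by
      rcases hi v h with rfl | rfl <;> simp at hv
    rw [dependsOn_update (hs v) hv', condExpect_of_dependsOn hw (hs v) hv']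
  rw [split]
  simp only [condExpect, smul_eq_mul]
  simp only [split fun v => √(g v (Function.update a i _)), rest]
  simp only [← mul_assoc, ← Finset.sum_mul]
  refine mul_le_mul_of_nonneg_right ?_ (Finset.prod_nonneg fun v _ => Real.sqrt_nonneg _)
  simp only [mul_assoc]
  exact sum_mul_sqrt_mul_sqrt_le (hw0 i) (fun x => hg _ _) (fun x => hg _ _)

/-- The Finner inequality with exponents `1/2`. -/
theorem expect_prod_sqrt_le {w : ∀ i, α i → ℝ} (hw0 : ∀ i x, 0 ≤ w i x)
    (hw : ∀ i, ∑ x, w i x = 1) {g : V → (∀ i, α i) → ℝ} (hg : ∀ v a, 0 ≤ g v a) {s : V → Set ι}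
    (hs : ∀ v, DependsOn (g v) (s v))
    (hi : ∀ i, ∃ v₁ v₂, v₁ ≠ v₂ ∧ ∀ v, i ∈ s v → v = v₁ ∨ v = v₂) :
    expect w (fun a => ∏ v, √(g v a)) ≤ ∏ v, √(expect w (g v)) := by
  -- The coordinates are averaged out of every factor one by one. The expectation of each factor
  -- stays the same, while the expectation of the product of square roots can only grow.
  have key : ∀ t : Finset ι, ∃ g' : V → (∀ i, α i) → ℝ, (∀ v a, 0 ≤ g' v a) ∧
      (∀ v, DependsOn (g' v) (s v \ t)) ∧ (∀ v, expect w (g' v) = expect w (g v)) ∧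
      expect w (fun a => ∏ v, √(g v a)) ≤ expect w (fun a => ∏ v, √(g' v a)) := by
    intro t
    induction t using Finset.induction_on with
    | empty => exact ⟨g, hg, by simpa using hs, fun _ => rfl, le_rfl⟩
    | insert i t hit ih =>
      obtain ⟨g', h0, h1, h2, h3⟩ := ih
      refine ⟨fun v => condExpect w i (g' v), fun v a => ?_, fun v => ?_, fun v => ?_, ?_⟩
      · exact Finset.sum_nonneg fun x _ => mul_nonneg (hw0 i x) (h0 _ _)
      · have := dependsOn_condExpect (w := w) (i := i) (h1 v)
        rwa [Set.sdiff_sdiff, Set.union_singleton, ← Finset.coe_insert] at this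
      · rw [expect_condExpect hw, h2]
      · refine h3.trans ?_
        rw [← expect_condExpect hw i]
        obtain ⟨v₁, v₂, hne, hv⟩ := hi i
        exact expect_mono hw0
          (condExpect_prod_sqrt_le hw0 hw h0 h1 hne fun v h => hv v h.1)
  obtain ⟨g', h0, h1, h2, h3⟩ := key Finset.univ
  have hc : ∀ v a b, g' v a = g' v b := fun v a b => h1 v fun i hi => absurd hi (by simp)
  rcases isEmpty_or_nonempty (∀ i, α i) with he | ⟨⟨a₀⟩⟩
  · simp only [expect, Finset.univ_eq_empty, Finset.sum_empty]
    exact Finset.prod_nonneg fun _ _ => Real.sqrt_nonneg _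
  · refine h3.trans (le_of_eq ?_)
    have : (fun a => ∏ v, √(g' v a)) = fun _ => ∏ v, √(g' v a₀) := by
      funext a
      simp only [hc _ a a₀]
    rw [this, expect_const hw]
    refine Finset.prod_congr rfl fun v _ => ?_
    rw [← h2 v, show g' v = fun _ => g' v a₀ from funext fun a => hc v a a₀, expect_const hw]

/-- Expansion of a square. For `c` the quotient of `∑ w f g` by `∑ w |g|²`, the least-squares
coefficient, it yields both the Cauchy–Schwarz inequality and its equality case. -/
theorem sum_weight_normSq_sub {X : Type*} [Fintype X] (w : X → ℝ) (f g : X → ℂ) (c : ℂ) :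
    ∑ x, w x * Complex.normSq (f x - c * star (g x)) = ∑ x, w x * Complex.normSq (f x)
      - 2 * (star c * ∑ x, w x • (f x * g x)).re
      + Complex.normSq c * ∑ x, w x * Complex.normSq (g x) := by
  simp only [Finset.mul_sum, Complex.re_sum]
  rw [← Finset.sum_sub_distrib, ← Finset.sum_add_distrib]
  refine Finset.sum_congr rfl fun x _ => ?_
  simp [Complex.normSq_apply]
  ring

theorem normSq_sum_weight_mul_le {X : Type*} [Fintype X] {w : X → ℝ} (hw : ∀ x, 0 < w x)
    (f g : X → ℂ) : Complex.normSq (∑ x, w x • (f x * g x)) ≤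
      (∑ x, w x * Complex.normSq (f x)) * ∑ x, w x * Complex.normSq (g x) := by
  set T := ∑ x, w x • (f x * g x) with hT
  set G := ∑ x, w x * Complex.normSq (g x) with hG
  have hG0 : 0 ≤ G := Finset.sum_nonneg fun x _ => mul_nonneg (hw x).le (Complex.normSq_nonneg _)
  rcases hG0.eq_or_lt with h | h
  · have hg : ∀ x, g x = 0 := fun x => by
      have := (Finset.sum_eq_zero_iff_of_nonneg
        fun x _ => mul_nonneg (hw x).le (Complex.normSq_nonneg (g x))).1 h.symm x (Finset.mem_univ x)
      simpa [(hw x).ne'] using this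
    simp [hT, hG, hg]
  · have key := sum_weight_normSq_sub w f g (T / (G : ℂ))
    rw [← hT, ← hG] at key
    have h0 : 0 ≤ ∑ x, w x * Complex.normSq (f x - T / (G : ℂ) * star (g x)) :=
      Finset.sum_nonneg fun x _ => mul_nonneg (hw x).le (Complex.normSq_nonneg _)
    have e1 : (star (T / (G : ℂ)) * T).re = Complex.normSq T / G := by
      have : star (T / (G : ℂ)) * T = ((Complex.normSq T / G : ℝ) : ℂ) := by
        push_cast
        rw [Complex.normSq_eq_conj_mul_self, star_div₀]
        simp only [Complex.star_def, Complex.conj_ofReal]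
        ring
      rw [this, Complex.ofReal_re]
    have e2 : Complex.normSq (T / (G : ℂ)) * G = Complex.normSq T / G := by
      rw [map_div₀, Complex.normSq_ofReal]
      field_simp
    rw [e1, e2] at key
    have : Complex.normSq T / G ≤ ∑ x, w x * Complex.normSq (f x) := by linarith
    rwa [div_le_iff₀ h] at this

theorem exists_eq_mul_star_of_normSq_sum_eq {X : Type*} [Fintype X] {w : X → ℝ}
    (hw : ∀ x, 0 < w x) {f g : X → ℂ} (hg : 0 < ∑ x, w x * Complex.normSq (g x))
    (h : Complex.normSq (∑ x, w x • (f x * g x)) =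
      (∑ x, w x * Complex.normSq (f x)) * ∑ x, w x * Complex.normSq (g x)) :
    ∃ c : ℂ, ∀ x, f x = c * star (g x) := by
  set T := ∑ x, w x • (f x * g x) with hT
  set G := ∑ x, w x * Complex.normSq (g x) with hG
  have key := sum_weight_normSq_sub w f g (T / (G : ℂ))
  rw [← hT, ← hG] at key
  have e1 : (star (T / (G : ℂ)) * T).re = Complex.normSq T / G := by
    have : star (T / (G : ℂ)) * T = ((Complex.normSq T / G : ℝ) : ℂ) := by
      push_cast
      rw [Complex.normSq_eq_conj_mul_self, star_div₀]
      simp only [Complex.star_def, Complex.conj_ofReal]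
      ring
    rw [this, Complex.ofReal_re]
  have e2 : Complex.normSq (T / (G : ℂ)) * G = Complex.normSq T / G := by
    rw [map_div₀, Complex.normSq_ofReal]
    field_simp
  have e3 : Complex.normSq T / G = ∑ x, w x * Complex.normSq (f x) := by
    rw [h]; field_simp
  rw [e1, e2, e3] at key
  have key0 : ∑ x, w x * Complex.normSq (f x - T / (G : ℂ) * star (g x)) = 0 := by linarith
  refine ⟨T / (G : ℂ), fun x => ?_⟩
  have := (Finset.sum_eq_zero_iff_of_nonneg
    fun x _ => mul_nonneg (hw x).le (Complex.normSq_nonneg _)).1 key0 x (Finset.mem_univ x)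
  rw [mul_eq_zero, Complex.normSq_eq_zero, sub_eq_zero] at this
  exact this.resolve_left (hw x).ne'

theorem norm_expect_le {w : ∀ i, α i → ℝ} (hw : ∀ i x, 0 ≤ w i x) (f : (∀ i, α i) → ℂ) :
    ‖expect w f‖ ≤ expect w (fun a => ‖f a‖) := by
  refine (norm_sum_le _ _).trans (le_of_eq (Finset.sum_congr rfl fun a _ => ?_))
  rw [norm_smul, Real.norm_of_nonneg (Finset.prod_nonneg fun i _ => hw i _), smul_eq_mul]

/-- The Finner inequality for complex functions, where two factors sharing the coordinate `i₀` are
first merged into their average over `i₀`. -/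
theorem norm_expect_prod_le_merged {w : ∀ i, α i → ℝ} (hw0 : ∀ i x, 0 ≤ w i x)
    (hw : ∀ i, ∑ x, w i x = 1) {k : V → (∀ i, α i) → ℂ} {s : V → Set ι}
    (hs : ∀ v, DependsOn (k v) (s v))
    (hi : ∀ i, ∃ v₁ v₂, v₁ ≠ v₂ ∧ ∀ v, i ∈ s v → v = v₁ ∨ v = v₂)
    {i₀ : ι} {v₁ v₂ : V} (hne : v₁ ≠ v₂) (hi₀ : ∀ v, i₀ ∈ s v → v = v₁ ∨ v = v₂) :
    ‖expect w (fun a => ∏ v, k v a)‖ ≤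
      √(expect w (fun a => Complex.normSq (condExpect w i₀ (fun a => k v₁ a * k v₂ a) a))) *
        ∏ v ∈ (Finset.univ.erase v₁).erase v₂, √(expect w (fun a => Complex.normSq (k v a))) := by
  have hk : ∀ v, v ≠ v₁ → v ≠ v₂ → i₀ ∉ s v := fun v h1 h2 h => by
    rcases hi₀ v h with h | h <;> contradiction
  have hmem : ∀ v, v ∈ (Finset.univ.erase v₁).erase v₂ ↔ v ≠ v₂ ∧ v ≠ v₁ := by simp
  set T := condExpect w i₀ (fun a => k v₁ a * k v₂ a) with hT
  -- The merged factor sits at `v₁`, and `v₂` keeps the trivial factor `1`, so that the family is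
  -- still indexed by `V`.
  let g : V → (∀ i, α i) → ℝ := fun v a =>
    if v = v₁ then Complex.normSq (T a) else if v = v₂ then 1 else Complex.normSq (k v a)
  let s' : V → Set ι := fun v =>
    if v = v₁ then (s v₁ ∪ s v₂) \ {i₀} else if v = v₂ then ∅ else s v
  have hg : ∀ v a, 0 ≤ g v a := by
    intro v a
    simp only [g]
    split_ifs
    exacts [Complex.normSq_nonneg _, zero_le_one, Complex.normSq_nonneg _]
  have hTs : DependsOn T ((s v₁ ∪ s v₂) \ {i₀}) := by
    refine dependsOn_condExpect fun a b hab => ?_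
    rw [hs v₁ fun i h => hab i (Or.inl h), hs v₂ fun i h => hab i (Or.inr h)]
  have hs' : ∀ v, DependsOn (g v) (s' v) := by
    intro v a b hab
    by_cases h1 : v = v₁
    · simp only [s', h1, if_true] at hab
      simp only [g, h1, if_true]
      rw [hTs hab]
    · by_cases h2 : v = v₂
      · simp [g, h2, hne.symm]
      · simp only [s', h1, h2, if_false] at hab
        simp only [g, h1, h2, if_false]
        rw [hs v hab]
  have hi' : ∀ i, ∃ v₁ v₂, v₁ ≠ v₂ ∧ ∀ v, i ∈ s' v → v = v₁ ∨ v = v₂ := by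
    intro i
    by_cases hii : i = i₀
    · refine ⟨v₁, v₂, hne, fun v hv => ?_⟩
      by_contra hcon
      push Not at hcon
      simp only [s', hcon.1, hcon.2, if_false] at hv
      exact hk v hcon.1 hcon.2 (hii ▸ hv)
    · have aux : ∀ v, i ∈ s' v → v = v₁ ∨ (v ≠ v₂ ∧ i ∈ s v) := by
        intro v hv
        by_cases h1 : v = v₁
        · exact Or.inl h1
        · by_cases h2 : v = v₂
          · simp [s', h2, hne.symm] at hv
          · simp only [s', h1, h2, if_false] at hv
            exact Or.inr ⟨h2, hv⟩
      obtain ⟨p, q, hpq, hv⟩ := hi i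
      -- After merging, the coordinates of `v₂` belong to `v₁`, so `v₁` takes the place of `v₂` as
      -- an end of `i`.
      by_cases h2 : i ∈ s v₂
      · have : ∃ q, ∀ v, i ∈ s' v → v = v₁ ∨ v = q := by
          rcases hv v₂ h2 with h | h
          · refine ⟨q, fun v h' => (aux v h').imp_right fun h'' => ?_⟩
            exact (hv v h''.2).resolve_left fun e => h''.1 (e.trans h.symm)
          · refine ⟨p, fun v h' => (aux v h').imp_right fun h'' => ?_⟩
            exact (hv v h''.2).resolve_right fun e => h''.1 (e.trans h.symm)
        obtain ⟨q, hq⟩ := this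
        by_cases hq1 : q = v₁
        · exact ⟨v₁, v₂, hne, fun v h => Or.inl ((hq v h).elim id fun e => e.trans hq1)⟩
        · exact ⟨v₁, q, Ne.symm hq1, hq⟩
      · refine ⟨p, q, hpq, fun v h => hv v ?_⟩
        by_cases h1 : v = v₁
        · simp only [s', h1, if_true] at h
          rw [h1]
          exact h.1.resolve_right h2
        · exact ((aux v h).resolve_left h1).2
  have hfin := expect_prod_sqrt_le hw0 hw hg hs' hi'
  have hcond : ∀ a, condExpect w i₀ (fun a => ∏ v, k v a) a =
      T a * ∏ v ∈ (Finset.univ.erase v₁).erase v₂, k v a := by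
    intro a
    simp only [hT, condExpect, Finset.sum_mul]
    refine Finset.sum_congr rfl fun x _ => ?_
    rw [prod_eq_mul_mul_prod_erase hne, smul_mul_assoc]
    congr 2
    refine Finset.prod_congr rfl fun v hv => ?_
    exact dependsOn_update (hs v) (hk v ((hmem v).1 hv).2 ((hmem v).1 hv).1) _ _
  have hnorm : ∀ a, ‖condExpect w i₀ (fun a => ∏ v, k v a) a‖ = ∏ v, √(g v a) := by
    intro a
    rw [hcond, norm_mul, norm_prod, prod_eq_mul_mul_prod_erase hne]
    simp only [g, if_true, hne.symm, if_false, Real.sqrt_one, mul_one]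
    congr 1
    refine Finset.prod_congr rfl fun v hv => ?_
    simp only [((hmem v).1 hv).1, ((hmem v).1 hv).2, if_false]
    rfl
  rw [← expect_condExpect hw i₀]
  refine (norm_expect_le hw0 _).trans ?_
  rw [show (fun a => ‖condExpect w i₀ (fun a => ∏ v, k v a) a‖) = fun a => ∏ v, √(g v a) from
    funext hnorm]
  refine hfin.trans (le_of_eq ?_)
  rw [prod_eq_mul_mul_prod_erase hne]
  have hone : expect w (g v₂) = 1 := by
    simp only [g, hne.symm, if_false, if_true]
    exact expect_const hw 1
  rw [hone, Real.sqrt_one, mul_one]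
  simp only [g, if_true]
  congr 1
  refine Finset.prod_congr rfl fun v hv => ?_
  simp only [((hmem v).1 hv).1, ((hmem v).1 hv).2, if_false]

/-- Equality in the Finner inequality on a simple graph forces each factor to be of product form
across each of its coordinates. -/
theorem exists_factor_of_finner_eq {w : ∀ i, α i → ℝ} (hw0 : ∀ i x, 0 < w i x)
    (hw : ∀ i, ∑ x, w i x = 1) {k : V → (∀ i, α i) → ℂ} {s : V → Set ι}
    (hs : ∀ v, DependsOn (k v) (s v))
    (hi : ∀ i, ∃ v₁ v₂, v₁ ≠ v₂ ∧ ∀ v, i ∈ s v → v = v₁ ∨ v = v₂)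
    {i₀ : ι} {v₁ v₂ : V} (hne : v₁ ≠ v₂) (hi₀ : ∀ v, i₀ ∈ s v → v = v₁ ∨ v = v₂)
    (hsimple : ∀ i, i ∈ s v₁ → i ∈ s v₂ → i = i₀)
    (hpos : 0 < ∏ v, √(expect w (fun a => Complex.normSq (k v a))))
    (heq : ∏ v, √(expect w (fun a => Complex.normSq (k v a))) ≤
      ‖expect w (fun a => ∏ v, k v a)‖) :
    ∃ (c : (∀ i, α i) → ℂ) (u : α i₀ → ℂ), ∀ a x, k v₁ (Function.update a i₀ x) = c a * u x := by
  have h1 := heq.trans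
    (norm_expect_prod_le_merged (fun i x => (hw0 i x).le) hw hs hi hne hi₀)
  rw [prod_eq_mul_mul_prod_erase hne] at h1 hpos
  set T := condExpect w i₀ (fun a => k v₁ a * k v₂ a) with hT
  have hprod0 : 0 ≤ ∏ v ∈ (Finset.univ.erase v₁).erase v₂,
      √(expect w (fun a => Complex.normSq (k v a))) :=
    Finset.prod_nonneg fun _ _ => Real.sqrt_nonneg _
  have hprodpos := lt_of_le_of_ne hprod0 (right_ne_zero_of_mul hpos.ne').symm
  have h2 := le_of_mul_le_mul_right h1 hprodpos
  have hE0 : ∀ v, 0 ≤ expect w (fun a => Complex.normSq (k v a)) := fun v =>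
    expect_nonneg (fun i x => (hw0 i x).le) fun a => Complex.normSq_nonneg _
  rw [← Real.sqrt_mul (hE0 _), Real.sqrt_le_sqrt_iff (expect_nonneg (fun i x => (hw0 i x).le)
    fun a => Complex.normSq_nonneg _)] at h2
  let n : V → (∀ i, α i) → ℝ := fun v => condExpect w i₀ (fun a => Complex.normSq (k v a))
  have hn : ∀ v, DependsOn (n v) (s v \ {i₀}) := fun v =>
    dependsOn_condExpect fun a b hab => by rw [hs v hab]
  have hle : ∀ a, Complex.normSq (T a) ≤ n v₁ a * n v₂ a := fun a =>
    normSq_sum_weight_mul_le (hw0 i₀) _ _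
  have hdisj : Disjoint (s v₁ \ {i₀}) (s v₂ \ {i₀}) := by
    rw [Set.disjoint_left]
    rintro i ⟨h1, h2⟩ ⟨h3, -⟩
    exact h2 (hsimple i h1 h3)
  -- Simplicity of the graph enters here: once the only shared coordinate `i₀` is averaged out, the
  -- two factors are independent.
  have hE : expect w (fun a => n v₁ a * n v₂ a) =
      expect w (fun a => Complex.normSq (k v₁ a)) * expect w (fun a => Complex.normSq (k v₂ a)) := by
    rw [expect_mul_of_disjoint hw (hn v₁) (hn v₂) hdisj, expect_condExpect hw,
      expect_condExpect hw]
  have hpt := eq_of_expect_eq hw0 hle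
    (le_antisymm (expect_mono (fun i x => (hw0 i x).le) hle) (hE.le.trans h2))
  have hv2 : 0 < expect w (n v₂) := by
    rw [expect_condExpect hw]
    refine lt_of_le_of_ne (hE0 v₂) fun h => ?_
    rw [← h] at hpos
    simp at hpos
  obtain ⟨b, hb⟩ : ∃ b, 0 < n v₂ b := by
    by_contra hcon
    push Not at hcon
    have := expect_mono (fun i x => (hw0 i x).le) hcon
    rw [expect_const hw] at this
    exact absurd hv2 this.not_gt
  classical
  -- Copying `b` on the coordinates of `v₂` changes `k v₁` in no coordinate but `i₀`, and freezes
  -- its Cauchy–Schwarz partner; hence `u` below does not depend on `a`.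
  let mix : (∀ i, α i) → (∀ i, α i) := fun a i => if i ∈ s v₂ then b i else a i
  have hmix2 : ∀ a x, k v₂ (Function.update (mix a) i₀ x) = k v₂ (Function.update b i₀ x) := by
    intro a x
    refine hs v₂ fun i hi => ?_
    by_cases hii : i = i₀
    · subst hii; simp
    · simp [Function.update_of_ne hii, mix, hi]
  have hmix1 : ∀ a x, k v₁ (Function.update (mix a) i₀ x) = k v₁ (Function.update a i₀ x) := by
    intro a x
    refine hs v₁ fun i hi => ?_
    by_cases hii : i = i₀
    · subst hii; simp
    · have : i ∉ s v₂ := fun h => hii (hsimple i hi h)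
      simp [Function.update_of_ne hii, mix, this]
  have hex : ∀ a, ∃ c : ℂ, ∀ x, k v₁ (Function.update (mix a) i₀ x) =
      c * star (k v₂ (Function.update (mix a) i₀ x)) := by
    intro a
    refine exists_eq_mul_star_of_normSq_sum_eq (hw0 i₀) ?_ (hpt (mix a))
    have : n v₂ (mix a) = n v₂ b := by
      simp only [n, condExpect, hmix2]
    rw [← this] at hb
    simpa only [n, condExpect, smul_eq_mul] using hb
  choose c hc using hex
  refine ⟨c, fun x => star (k v₂ (Function.update b i₀ x)), fun a x => ?_⟩
  rw [← hmix1, hc, hmix2]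

end Finner

/-! ### Tensor network contractions, regrouped by sources or by parties. -/

section Pairing

variable {N M : ℕ} {E : Fin N → Fin M → Bool} {A A' : Fin N → Fin M → Type*}

/-- A configuration of the edges of the network, seen as a family of configurations of the edges at
each source. -/
def rowEquiv (E : Fin N → Fin M → Bool) (A : Fin N → Fin M → Type*) :
    (∀ e : {e : Fin N × Fin M // E e.1 e.2}, A e.1.1 e.1.2) ≃
      ∀ i, ∀ j : {j // E i j}, A i j where
  toFun ξ i j := ξ ⟨(i, j.1), j.2⟩
  invFun η e := η e.1.1 ⟨e.1.2, e.2⟩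
  left_inv _ := rfl
  right_inv _ := rfl

/-- A configuration of the edges of the network, seen as a family of configurations of the edges at
each party. -/
def colEquiv (E : Fin N → Fin M → Bool) (A : Fin N → Fin M → Type*) :
    (∀ e : {e : Fin N × Fin M // E e.1 e.2}, A e.1.1 e.1.2) ≃
      ∀ j, ∀ i : {i // E i j}, A i j where
  toFun ξ j i := ξ ⟨(i.1, j), i.2⟩
  invFun η e := η e.1.2 ⟨e.1.1, e.2⟩
  left_inv _ := rfl
  right_inv _ := rfl

theorem prod_rows {R : Type*} [CommMonoid R] (f : {e : Fin N × Fin M // E e.1 e.2} → R) :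
    ∏ i, ∏ j : {j // E i j}, f ⟨(i, j.1), j.2⟩ = ∏ e, f e := by
  let e : (Σ i : Fin N, {j // E i j}) ≃ {e : Fin N × Fin M // E e.1 e.2} :=
    { toFun q := ⟨(q.1, q.2.1), q.2.2⟩
      invFun e := ⟨e.1.1, ⟨e.1.2, e.2⟩⟩
      left_inv _ := rfl
      right_inv _ := rfl }
  rw [← Fintype.prod_sigma']
  exact Fintype.prod_equiv e _ _ fun _ => rfl

theorem prod_cols {R : Type*} [CommMonoid R] (f : {e : Fin N × Fin M // E e.1 e.2} → R) :
    ∏ j, ∏ i : {i // E i j}, f ⟨(i.1, j), i.2⟩ = ∏ e, f e := by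
  let e : (Σ j : Fin M, {i // E i j}) ≃ {e : Fin N × Fin M // E e.1 e.2} :=
    { toFun q := ⟨(q.2.1, q.1), q.2.2⟩
      invFun e := ⟨e.1.2, ⟨e.1.1, e.2⟩⟩
      left_inv _ := rfl
      right_inv _ := rfl }
  rw [← Fintype.prod_sigma']
  exact Fintype.prod_equiv e _ _ fun _ => rfl

theorem prod_sum_pi {ι R : Type*} [Fintype ι] [DecidableEq ι] [CommSemiring R] {κ : ι → Type*}
    [∀ i, Fintype (κ i)] (f : ∀ i, κ i → R) :
    ∏ i, ∑ x, f i x = ∑ x : (∀ i, κ i), ∏ i, f i (x i) := by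
  rw [Finset.prod_univ_sum, Fintype.piFinset_univ]

variable [∀ i j, Fintype (A i j)] [∀ i j, Fintype (A' i j)]

theorem prod_sum_rows {R : Type*} [CommSemiring R] (f : ∀ i, (∀ j : {j // E i j}, A i j) → R) :
    ∏ i, ∑ x, f i x = ∑ ξ : (∀ e : {e : Fin N × Fin M // E e.1 e.2}, A e.1.1 e.1.2),
      ∏ i, f i (fun j => ξ ⟨(i, j.1), j.2⟩) := by
  rw [prod_sum_pi]
  exact (Fintype.sum_equiv (rowEquiv E A) _ _ fun _ => rfl).symm

theorem prod_sum_cols {R : Type*} [CommSemiring R] (f : ∀ j, (∀ i : {i // E i j}, A i j) → R) :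
    ∏ j, ∑ x, f j x = ∑ ξ : (∀ e : {e : Fin N × Fin M // E e.1 e.2}, A e.1.1 e.1.2),
      ∏ j, f j (fun i => ξ ⟨(i.1, j), i.2⟩) := by
  rw [prod_sum_pi]
  exact (Fintype.sum_equiv (colEquiv E A) _ _ fun _ => rfl).symm

/-- The contraction of the tensor network with a tensor `r i` at each source and a tensor `X j` at
each party, one index per connected pair. -/
def pairing (r : ∀ i, (∀ j : {j // E i j}, A i j) → ℂ) (X : ∀ j, (∀ i : {i // E i j}, A i j) → ℂ) :
    ℂ :=
  ∑ ξ : (∀ e : {e : Fin N × Fin M // E e.1 e.2}, A e.1.1 e.1.2),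
    (∏ i, r i (fun j => ξ ⟨(i, j.1), j.2⟩)) * ∏ j, X j (fun i => ξ ⟨(i.1, j), i.2⟩)

/-- Local linear maps can be moved from the sources to the parties. -/
theorem pairing_transport (k : ∀ i (j : {j // E i j}), A i j → A' i j → ℂ)
    (σ : ∀ i, (∀ j : {j // E i j}, A' i j) → ℂ) (X : ∀ j, (∀ i : {i // E i j}, A i j) → ℂ) :
    pairing (fun i ξ => ∑ η, (∏ j : {j // E i j}, k i j (ξ j) (η j)) * σ i η) X =
      pairing σ (fun j η => ∑ ξ, (∏ i : {i // E i j}, k i.1 ⟨j, i.2⟩ (ξ i) (η i)) * X j ξ) := by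
  simp only [pairing, prod_sum_rows, prod_sum_cols, Finset.prod_mul_distrib, Finset.sum_mul,
    Finset.mul_sum]
  rw [Finset.sum_comm]
  refine Finset.sum_congr rfl fun η _ => Finset.sum_congr rfl fun ξ _ => ?_
  rw [prod_rows (fun e => k e.1.1 ⟨e.1.2, e.2⟩ (ξ e) (η e)),
    prod_cols (fun e => k e.1.1 ⟨e.1.2, e.2⟩ (ξ e) (η e))]
  ring

/-- If the tensor of each source is a combination of product tensors, then the contraction is a sum
over one index per source. -/
theorem pairing_eq_sum {D : Fin N → Type*} [∀ i, Fintype (D i)] (k : ∀ i (j : {j // E i j}), A i j → D i → ℂ)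
    (c : ∀ i, D i → ℂ) (X : ∀ j, (∀ i : {i // E i j}, A i j) → ℂ) :
    pairing (fun i ξ => ∑ d, c i d * ∏ j : {j // E i j}, k i j (ξ j) d) X =
      ∑ d : (∀ i, D i), (∏ i, c i (d i)) *
        ∏ j, ∑ ξ : (∀ i : {i // E i j}, A i j), (∏ i : {i // E i j}, k i.1 ⟨j, i.2⟩ (ξ i) (d i)) * X j ξ := by
  simp only [pairing, prod_sum_pi fun i d => c i d * _, prod_sum_cols, Finset.prod_mul_distrib,
    Finset.sum_mul, Finset.mul_sum]
  rw [Finset.sum_comm]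
  refine Finset.sum_congr rfl fun d _ => Finset.sum_congr rfl fun ξ _ => ?_
  rw [prod_rows (fun e => k e.1.1 ⟨e.1.2, e.2⟩ (ξ e) (d e.1.1)),
    prod_cols (fun e => k e.1.1 ⟨e.1.2, e.2⟩ (ξ e) (d e.1.1))]
  ring

theorem sum_pairing {O : Fin M → Type*} [∀ j, Fintype (O j)]
    (r : ∀ i, (∀ j : {j // E i j}, A i j) → ℂ) (X : ∀ j, O j → (∀ i : {i // E i j}, A i j) → ℂ) :
    ∑ a : (∀ j, O j), pairing r (fun j => X j (a j)) = pairing r (fun j ξ => ∑ o, X j o ξ) := by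
  simp only [pairing]
  rw [Finset.sum_comm]
  simp only [prod_sum_pi, Finset.mul_sum]

end Pairing

/-! ### Singular value decomposition restricted to the nonzero singular values. -/

section Svd

open Matrix

/-- Diagonalize `C * Cᴴ` by a unitary `W`. The rows of `Wᴴ * C` are orthogonal with squared norms
the eigenvalues; the zero rows are dropped and the others normalized. -/
theorem exists_svd {a c : Type} [Fintype a] [DecidableEq a] [Fintype c] (C : Matrix a c ℂ) :
    ∃ (r : ℕ) (v : Fin r → ℝ) (U : Matrix a (Fin r) ℂ) (Φ : Matrix c (Fin r) ℂ),
      (∀ s, 0 < v s) ∧ Uᴴ * U = 1 ∧ Φᴴ * Φ = 1 ∧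
      C = U * diagonal (fun s => ((√(v s) : ℝ) : ℂ)) * Φᵀ := by
  have hpsd : (C * Cᴴ).PosSemidef := posSemidef_self_mul_conjTranspose C
  have hH := hpsd.isHermitian
  set v := hH.eigenvalues with hv
  have hv0 : ∀ s, 0 ≤ v s := hpsd.eigenvalues_nonneg
  let W : Matrix a a ℂ := hH.eigenvectorUnitary
  have hWW : Wᴴ * W = 1 := Unitary.coe_star_mul_self hH.eigenvectorUnitary
  have hWW' : W * Wᴴ = 1 := Unitary.coe_mul_star_self hH.eigenvectorUnitary
  have hspec : C * Cᴴ = W * diagonal (fun s => ((v s : ℝ) : ℂ)) * Wᴴ := by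
    have := hH.spectral_theorem
    rw [Unitary.conjStarAlgAut_apply] at this
    exact this
  set u : Matrix a c ℂ := Wᴴ * C with hu
  have huu : u * uᴴ = diagonal (fun s => ((v s : ℝ) : ℂ)) := by
    rw [hu, conjTranspose_mul, conjTranspose_conjTranspose]
    calc Wᴴ * C * (Cᴴ * W) = Wᴴ * (C * Cᴴ) * W := by simp only [Matrix.mul_assoc]
      _ = (Wᴴ * W) * diagonal (fun s => ((v s : ℝ) : ℂ)) * (Wᴴ * W) := by
          rw [hspec]; simp only [Matrix.mul_assoc]
      _ = _ := by rw [hWW]; simp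
  have hCu : C = W * u := by rw [hu, ← Matrix.mul_assoc, hWW', Matrix.one_mul]
  have huz : ∀ s, v s = 0 → ∀ x, u s x = 0 := by
    intro s hs x
    have h := congrFun (congrFun huu s) s
    rw [diagonal_apply_eq, hs, mul_apply] at h
    simp only [conjTranspose_apply, Complex.star_def, Complex.mul_conj, ← Complex.ofReal_sum,
      Complex.ofReal_inj] at h
    have := (Finset.sum_eq_zero_iff_of_nonneg
      fun x _ => Complex.normSq_nonneg (u s x)).1 h x (Finset.mem_univ x)
    exact Complex.normSq_eq_zero.1 this
  let S := {s : a // 0 < v s}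
  let e : Fin (Fintype.card S) ≃ S := (Fintype.equivFin S).symm
  refine ⟨Fintype.card S, fun s => v (e s).1, W.submatrix id (fun s => (e s).1),
    of fun x s => u (e s).1 x / ((√(v (e s).1) : ℝ) : ℂ), fun s => (e s).2, ?_, ?_, ?_⟩
  · ext s t
    have := congrFun (congrFun hWW (e s).1) (e t).1
    rw [mul_apply] at this ⊢
    simp only [conjTranspose_apply, submatrix_apply, id] at this ⊢
    rw [this, one_apply, one_apply]
    simp [Subtype.val_inj]
  · ext s t
    have := congrFun (congrFun huu (e t).1) (e s).1
    rw [mul_apply] at this ⊢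
    simp only [conjTranspose_apply, of_apply] at this ⊢
    have h2 : ∀ x, star (u (e s).1 x / ((√(v (e s).1) : ℝ) : ℂ)) *
        (u (e t).1 x / ((√(v (e t).1) : ℝ) : ℂ)) =
        (u (e t).1 x * star (u (e s).1 x)) / (((√(v (e s).1) : ℝ) : ℂ) * ((√(v (e t).1) : ℝ) : ℂ)) := by
      intro x
      rw [star_div₀, Complex.star_def, Complex.conj_ofReal, div_mul_div_comm,
        mul_comm (u _ _)]
    simp only [h2, ← Finset.sum_div, this]
    by_cases hst : s = t
    · subst hst
      rw [diagonal_apply_eq, one_apply_eq, ← Complex.ofReal_mul, Real.mul_self_sqrt (hv0 _),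
        div_self]
      exact_mod_cast (e s).2.ne'
    · rw [diagonal_apply_ne, one_apply_ne hst, zero_div]
      intro h
      exact hst (e.injective (Subtype.ext h)).symm
  · ext x y
    rw [hCu, mul_apply, mul_apply]
    have h1 : ∀ s : Fin (Fintype.card S), (W.submatrix id (fun s => (e s).1) *
        diagonal (fun s => ((√(v (e s).1) : ℝ) : ℂ))) x s *
        (of fun x s => u (e s).1 x / ((√(v (e s).1) : ℝ) : ℂ))ᵀ s y = W x (e s).1 * u (e s).1 y := by
      intro s
      have : ((√(v (e s).1) : ℝ) : ℂ) ≠ 0 := by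
        exact_mod_cast (Real.sqrt_pos.2 (e s).2).ne'
      simp only [mul_diagonal, submatrix_apply, id, transpose_apply, of_apply]
      field_simp
    simp only [h1]
    rw [Equiv.sum_comp e fun s : S => W x s.1 * u s.1 y]
    rw [← Fintype.sum_subtype_add_sum_subtype (fun s => 0 < v s), add_eq_left]
    refine Finset.sum_eq_zero fun s _ => ?_
    rw [huz s.1 (le_antisymm (not_lt.1 s.2) (hv0 _)), mul_zero]

end Svd

/-! ### Schmidt decompositions of purified bipartite states. -/

section Schmidt

open Matrix
open scoped MatrixOrder

/-- A Schmidt decomposition of a purification of the state `ρ` of two systems, in which the system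
`n` is not enlarged: there are a common Schmidt index in `Fin r` with weights `v`, and for each
system `j` the Schmidt vectors of `j` and its part of the purifying system, whose components for the
state `p` of the purifying system form the matrix `B j p`. -/
structure IsSchmidt {J : Type} [Fintype J] [DecidableEq J] {d : J → ℕ} {P : Type} [Fintype P]
    (ρ : Matrix (∀ j, Fin (d j)) (∀ j, Fin (d j)) ℂ) (n : J) {r : ℕ} (v : Fin r → ℝ)
    (B : ∀ j, P → Matrix (Fin (d j)) (Fin r) ℂ) : Prop where
  pos : ∀ s, 0 < v s
  sum_eq_one : ∑ s, v s = 1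
  isometry : ∀ j, ∑ p, (B j p)ᴴ * B j p = 1
  eq_sum : ∀ x y, ρ x y = ∑ q : Fin r × Fin r, ((√(v q.1) * √(v q.2) : ℝ) : ℂ) *
    ∏ j, ∑ p, B j p (x j) q.1 * star (B j p (y j) q.2)
  near : ∃ p₀, (∀ p, p ≠ p₀ → B n p = 0) ∧
    (of fun s t => ∑ z : (∀ j, Fin (d j)), if z n = s then ρ z (Function.update z n t) else 0) =
      B n p₀ * diagonal (fun s => (v s : ℂ)) * (B n p₀)ᴴ

/-- Write `ρ = A * Aᴴ`, so that the column index of `A` is a purifying system. Grouping it with the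
other system `f` turns `A` into a matrix from `n` to `f` and the purifying system, whose singular
value decomposition is the Schmidt decomposition. -/
theorem exists_isSchmidt {J : Type} [Fintype J] [DecidableEq J] (hJ : Fintype.card J = 2)
    {d : J → ℕ} {ρ : Matrix (∀ j, Fin (d j)) (∀ j, Fin (d j)) ℂ} (hρ : IsDensity ρ) (n : J) :
    ∃ (r : ℕ) (v : Fin r → ℝ) (B : ∀ j, (∀ j, Fin (d j)) → Matrix (Fin (d j)) (Fin r) ℂ),
      IsSchmidt ρ n v B := by
  obtain ⟨f, hf, huniv⟩ : ∃ f, f ≠ n ∧ ∀ j, j = n ∨ j = f := by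
    obtain ⟨a, b, hab, hu⟩ := Finset.card_eq_two.1 (Finset.card_univ.trans hJ)
    have hu' : ∀ j, j = a ∨ j = b := fun j => by simpa [hu] using Finset.mem_univ j
    rcases hu' n with rfl | rfl
    exacts [⟨b, hab.symm, hu'⟩, ⟨a, hab, fun j => (hu' j).symm⟩]
  obtain ⟨z₀⟩ : Nonempty (∀ j, Fin (d j)) := by
    by_contra h
    rw [not_nonempty_iff] at h
    have := hρ.trace_eq_one
    simp [Matrix.trace] at this
  have hprod : ∀ {R : Type} [CommMonoid R] (g : J → R), ∏ j, g j = g n * g f := by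
    intro R _ g
    have : (Finset.univ : Finset J) = {n, f} := by
      ext j; simpa using huniv j
    rw [this, Finset.prod_pair hf.symm]
  let e : (∀ j, Fin (d j)) ≃ Fin (d n) × Fin (d f) :=
    { toFun z := (z n, z f)
      invFun q := Function.update (Function.update z₀ n q.1) f q.2
      left_inv z := by
        funext j
        rcases huniv j with rfl | rfl
        · simp [Function.update_of_ne hf.symm]
        · simp
      right_inv q := by
        ext <;> simp [Function.update_of_ne hf.symm] }
  obtain ⟨A, hA⟩ : ∃ A : Matrix (∀ j, Fin (d j)) (∀ j, Fin (d j)) ℂ, ρ = A * Aᴴ := by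
    obtain ⟨A, hA⟩ := CStarAlgebra.nonneg_iff_eq_star_mul_self.1 hρ.posSemidef.nonneg
    rw [star_eq_conjTranspose] at hA
    exact ⟨Aᴴ, by rw [hA, conjTranspose_conjTranspose]⟩
  let C : Matrix (Fin (d n)) (Fin (d f) × (∀ j, Fin (d j))) ℂ :=
    of fun a b => A (e.symm (a, b.1)) b.2
  obtain ⟨r, v, U, Φ, hv, hU, hΦ, hC⟩ := exists_svd C
  have hAC : ∀ x q, A x q = ∑ s, U (x n) s * ((√(v s) : ℝ) : ℂ) * Φ (x f, q) s := by
    intro x q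
    have := congrFun (congrFun hC (x n)) (x f, q)
    rw [mul_apply] at this
    simp only [mul_diagonal, transpose_apply] at this
    rw [← this]
    simp only [C, of_apply]
    rw [show (x n, x f) = e x from rfl, e.symm_apply_apply]
  have hred : (of fun s t => ∑ z : (∀ j, Fin (d j)),
      if z n = s then ρ z (Function.update z n t) else 0) =
      U * diagonal (fun s => (v s : ℂ)) * Uᴴ := by
    have h1 : (of fun s t => ∑ z : (∀ j, Fin (d j)),
      if z n = s then ρ z (Function.update z n t) else 0) = C * Cᴴ := by
      ext s t
      rw [of_apply, ← Equiv.sum_comp e.symm, Fintype.sum_prod_type, mul_apply,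
        Fintype.sum_prod_type]
      have hs : ∀ (a : Fin (d n)) b, (e.symm (a, b)) n = a := fun a b =>
        congrArg Prod.fst (e.apply_symm_apply (a, b))
      have ht : ∀ (a : Fin (d n)) b, Function.update (e.symm (a, b)) n t = e.symm (t, b) := by
        intro a b
        apply e.injective
        rw [e.apply_symm_apply]
        ext
        · simp [e]
        · simp [e, Function.update_of_ne hf]
      simp only [hs, ht]
      rw [Finset.sum_eq_single s (by intro a _ ha; simp [ha]) (by simp)]
      refine Finset.sum_congr rfl fun b _ => ?_
      rw [if_pos rfl, hA, mul_apply]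
      rfl
    have hΦ' : Φᵀ * Φᵀᴴ = 1 := by
      have := congrArg transpose hΦ
      rw [transpose_mul, transpose_one] at this
      exact this
    have hD : diagonal (fun s => ((√(v s) : ℝ) : ℂ)) * (diagonal (fun s => ((√(v s) : ℝ) : ℂ)))ᴴ
        = diagonal (fun s => (v s : ℂ)) := by
      rw [diagonal_conjTranspose, diagonal_mul_diagonal]
      congr 1
      funext s
      rw [Pi.star_apply, Complex.star_def, Complex.conj_ofReal, ← Complex.ofReal_mul,
        Real.mul_self_sqrt (hv s).le]
    rw [h1, hC, conjTranspose_mul, conjTranspose_mul]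
    calc _ = U * (diagonal (fun s => ((√(v s) : ℝ) : ℂ)) * (Φᵀ * Φᵀᴴ) *
          (diagonal (fun s => ((√(v s) : ℝ) : ℂ)))ᴴ) * Uᴴ := by simp only [Matrix.mul_assoc]
      _ = _ := by rw [hΦ', Matrix.mul_one, hD]
  -- The system `n` gets only a dummy auxiliary state `z₀`. The updates of `z₀` merely transport an
  -- index of type `Fin (d j)` to `Fin (d n)` or `Fin (d f)`.
  let B : ∀ j, (∀ j, Fin (d j)) → Matrix (Fin (d j)) (Fin r) ℂ := fun j p => of fun x s =>
    if j = n then (if p = z₀ then U (Function.update z₀ j x n) s else 0)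
      else Φ (Function.update z₀ j x f, p) s
  have hBn : ∀ p, B n p = if p = z₀ then U else 0 := by
    intro p
    ext x s
    simp only [B, if_true, of_apply, Function.update_self]
    split_ifs <;> rfl
  have hBf : ∀ p x s, B f p x s = Φ (x, p) s := by
    intro p x s
    simp only [B, hf, if_false, of_apply, Function.update_self]
  refine ⟨r, v, B, hv, ?_, ?_, ?_, z₀, ?_, ?_⟩
  · have h1 : (of fun s t => ∑ z : (∀ j, Fin (d j)),
      if z n = s then ρ z (Function.update z n t) else 0).trace = 1 := by
      rw [← hρ.trace_eq_one]
      simp only [Matrix.trace, diag, of_apply]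
      rw [Finset.sum_comm]
      refine Finset.sum_congr rfl fun z _ => ?_
      rw [Finset.sum_ite_eq]
      simp
    rw [hred, Matrix.trace_mul_comm, ← Matrix.mul_assoc, hU, Matrix.one_mul,
      Matrix.trace_diagonal] at h1
    exact_mod_cast h1
  · intro j
    rcases huniv j with rfl | rfl
    · rw [Finset.sum_eq_single z₀ (fun p _ hp => by simp [hBn, hp]) (by simp), hBn, if_pos rfl, hU]
    · rw [← hΦ]
      ext s t
      rw [Matrix.sum_apply]
      simp only [mul_apply, conjTranspose_apply, hBf, Fintype.sum_prod_type]
      rw [Finset.sum_comm]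
  · intro x y
    rw [hA, mul_apply]
    simp only [conjTranspose_apply, hAC, star_sum, Fintype.sum_prod_type, hprod]
    rw [Finset.sum_congr rfl fun q _ => Finset.sum_mul_sum _ _ _ _]
    rw [Finset.sum_comm]
    refine Finset.sum_congr rfl fun s _ => ?_
    rw [Finset.sum_comm]
    refine Finset.sum_congr rfl fun t _ => ?_
    have hn : ∑ p, B n p (x n) s * star (B n p (y n) t) = U (x n) s * star (U (y n) t) := by
      rw [Finset.sum_eq_single z₀ (fun p _ hp => by simp [hBn, hp]) (by simp), hBn, if_pos rfl]
    rw [hn]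
    simp only [hBf, Finset.mul_sum]
    refine Finset.sum_congr rfl fun q _ => ?_
    simp only [star_mul', Complex.star_def, Complex.conj_ofReal]
    push_cast
    ring
  · intro p hp
    rw [hBn, if_neg hp]
  · rw [hBn, if_pos rfl, hred]

end Schmidt

open Matrix

/-! ### Tensor products of matrices and compressions by local maps. -/

section Tensor

variable {I : Type*} [Fintype I] [DecidableEq I] {κ μ ν P : I → Type*}
  [∀ i, Fintype (κ i)] [∀ i, DecidableEq (κ i)] [∀ i, Fintype (μ i)] [∀ i, DecidableEq (μ i)]
  [∀ i, Fintype (ν i)] [∀ i, Fintype (P i)]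

theorem tensorMatrix_mul (A : ∀ i, Matrix (κ i) (μ i) ℂ) (B : ∀ i, Matrix (μ i) (ν i) ℂ) :
    tensorMatrix A * tensorMatrix B = tensorMatrix fun i => A i * B i := by
  ext x y
  simp only [mul_apply, tensorMatrix, of_apply, prod_sum_pi, Finset.prod_mul_distrib]

theorem conjTranspose_tensorMatrix (A : ∀ i, Matrix (κ i) (μ i) ℂ) :
    (tensorMatrix A)ᴴ = tensorMatrix fun i => (A i)ᴴ := by
  ext x y
  simp only [conjTranspose_apply, tensorMatrix, of_apply, star_prod]

theorem tensorMatrix_one : (tensorMatrix fun i => (1 : Matrix (κ i) (κ i) ℂ)) = 1 := by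
  ext x y
  simp only [tensorMatrix, of_apply, one_apply]
  rw [Fintype.prod_boole]
  simp [funext_iff]

theorem tensorMatrix_smul (c : I → ℂ) (A : ∀ i, Matrix (κ i) (μ i) ℂ) :
    (tensorMatrix fun i => c i • A i) = (∏ i, c i) • tensorMatrix A := by
  ext x y
  simp only [tensorMatrix, of_apply, Matrix.smul_apply, smul_eq_mul, Finset.prod_mul_distrib]

theorem sum_tensorMatrix (A : ∀ i, P i → Matrix (κ i) (μ i) ℂ) :
    ∑ p : (∀ i, P i), (tensorMatrix fun i => A i (p i)) = tensorMatrix fun i => ∑ p, A i p := by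
  ext x y
  simp only [Matrix.sum_apply, tensorMatrix, of_apply, prod_sum_pi]

/-- A pair of configurations as a configuration of pairs. -/
def piProdEquiv (κ μ : I → Type*) : (∀ i, κ i × μ i) ≃ (∀ i, κ i) × (∀ i, μ i) where
  toFun ξ := (fun i => (ξ i).1, fun i => (ξ i).2)
  invFun q i := (q.1 i, q.2 i)
  left_inv _ := rfl
  right_inv _ := rfl

/-- The compression `∑ p, (⨂ i, B i (p i))ᴴ X (⨂ i, B i (p i))` of `X ⊗ 1` by a product of local
maps to the systems and auxiliary systems `P i`. -/
def compress (B : ∀ i, P i → Matrix (κ i) (μ i) ℂ) (X : Matrix (∀ i, κ i) (∀ i, κ i) ℂ) :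
    Matrix (∀ i, μ i) (∀ i, μ i) ℂ :=
  ∑ p : (∀ i, P i), (tensorMatrix fun i => B i (p i))ᴴ * X * tensorMatrix fun i => B i (p i)

/-- Each entry is a contraction with a product of local kernels, the shape in which compressions
come out of `pairing_eq_sum` and `pairing_transport`. -/
theorem compress_apply (B : ∀ i, P i → Matrix (κ i) (μ i) ℂ) (X : Matrix (∀ i, κ i) (∀ i, κ i) ℂ)
    (t s : ∀ i, μ i) : compress B X t s = ∑ ξ : (∀ i, κ i × κ i),
      (∏ i, ∑ p, B i p (ξ i).1 (s i) * star (B i p (ξ i).2 (t i))) *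
        X (fun i => (ξ i).2) (fun i => (ξ i).1) := by
  rw [← Equiv.sum_comp (piProdEquiv κ κ).symm, Fintype.sum_prod_type]
  simp only [compress, Matrix.sum_apply, mul_apply, prod_sum_pi, Finset.sum_mul]
  rw [Finset.sum_comm]
  refine Finset.sum_congr rfl fun x _ => ?_
  rw [Finset.sum_comm]
  refine Finset.sum_congr rfl fun y _ => ?_
  refine Finset.sum_congr rfl fun p _ => ?_
  simp only [conjTranspose_apply, tensorMatrix, of_apply, piProdEquiv, Equiv.coe_fn_symm_mk,
    Finset.prod_mul_distrib, star_prod]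
  ring

theorem compress_posSemidef (B : ∀ i, P i → Matrix (κ i) (μ i) ℂ)
    {X : Matrix (∀ i, κ i) (∀ i, κ i) ℂ} (hX : X.PosSemidef) : (compress B X).PosSemidef :=
  posSemidef_sum _ fun _ _ => hX.conjTranspose_mul_mul_same _

theorem compress_sub (B : ∀ i, P i → Matrix (κ i) (μ i) ℂ) (X Y : Matrix (∀ i, κ i) (∀ i, κ i) ℂ) :
    compress B (X - Y) = compress B X - compress B Y := by
  simp only [compress, Matrix.mul_sub, Matrix.sub_mul, Finset.sum_sub_distrib]

theorem compress_one {B : ∀ i, P i → Matrix (κ i) (μ i) ℂ} (hB : ∀ i, ∑ p, (B i p)ᴴ * B i p = 1) :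
    compress B 1 = 1 := by
  simp only [compress, Matrix.mul_one, conjTranspose_tensorMatrix, tensorMatrix_mul,
    sum_tensorMatrix fun i p => (B i p)ᴴ * B i p, hB, tensorMatrix_one]

end Tensor

/-! ### Effects that equality forces to be projections. -/

section Projections

variable {n : Type*} [Fintype n] [DecidableEq n]

/-- `F - F * F = F * (1 - F) * F + (1 - F) * F * (1 - F)`. -/
theorem posSemidef_sub_mul_self {F : Matrix n n ℂ} (hF : F.PosSemidef) (hF' : (1 - F).PosSemidef) :
    (F - F * F).PosSemidef := by
  have h1 := hF'.conjTranspose_mul_mul_same F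
  have h2 := hF.conjTranspose_mul_mul_same (1 - F)
  rw [hF.isHermitian.eq] at h1
  rw [hF'.isHermitian.eq] at h2
  convert h1.add h2 using 1
  noncomm_ring

theorem re_mul_self_apply {F : Matrix n n ℂ} (hF : F.IsHermitian) (s : n) :
    ((F * F) s s).re = ∑ t, Complex.normSq (F t s) := by
  rw [mul_apply, Complex.re_sum]
  refine Finset.sum_congr rfl fun t _ => ?_
  rw [← hF.apply s t, Complex.star_def, ← Complex.normSq_eq_conj_mul_self, Complex.ofReal_re]

/-- `√(v t) * √(v s)` is at most the mean of `v t` and `v s`, and both terms of the mean give the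
right-hand side since `|F t s|` is symmetric. -/
theorem sum_sqrt_mul_normSq_le {F : Matrix n n ℂ} (hF : F.PosSemidef) {v : n → ℝ}
    (hv : ∀ s, 0 < v s) :
    ∑ t, ∑ s, √(v t) * √(v s) * Complex.normSq (F t s) ≤ ∑ s, v s * ((F * F) s s).re := by
  have hsymm : ∀ s t, Complex.normSq (F t s) = Complex.normSq (F s t) := by
    intro s t
    rw [← hF.isHermitian.apply s t, Complex.star_def, Complex.normSq_conj]
  have h1 : ∑ t, ∑ s, v s * Complex.normSq (F t s) = ∑ s, v s * ((F * F) s s).re := by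
    rw [Finset.sum_comm]
    simp only [re_mul_self_apply hF.isHermitian, Finset.mul_sum]
  have h2 : ∑ t, ∑ s, v t * Complex.normSq (F t s) = ∑ s, v s * ((F * F) s s).re := by
    simp only [re_mul_self_apply hF.isHermitian, Finset.mul_sum]
    exact Finset.sum_congr rfl fun s _ => Finset.sum_congr rfl fun t _ => by rw [hsymm]
  have h3 : ∑ t, ∑ s, √(v t) * √(v s) * Complex.normSq (F t s) ≤
      ∑ t, ∑ s, (v t * Complex.normSq (F t s) + v s * Complex.normSq (F t s)) / 2 := by
    refine Finset.sum_le_sum fun t _ => Finset.sum_le_sum fun s _ => ?_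
    rw [← add_mul, mul_div_right_comm]
    refine mul_le_mul_of_nonneg_right ?_ (Complex.normSq_nonneg _)
    nlinarith [sq_nonneg (√(v t) - √(v s)), Real.sq_sqrt (hv t).le, Real.sq_sqrt (hv s).le]
  simp only [← Finset.sum_div, Finset.sum_add_distrib, h1, h2] at h3
  linarith

theorem sum_mul_re_mul_self_le {F : Matrix n n ℂ} (hF : F.PosSemidef) (hF' : (1 - F).PosSemidef)
    {v : n → ℝ} (hv : ∀ s, 0 < v s) :
    ∑ s, v s * ((F * F) s s).re ≤ ∑ s, v s * (F s s).re := by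
  refine Finset.sum_le_sum fun s _ => mul_le_mul_of_nonneg_left ?_ (hv s).le
  have := (Complex.le_def.1 ((posSemidef_sub_mul_self hF hF').diag_nonneg (i := s))).1
  simpa using this

/-- `F - F * F` is positive semidefinite and its diagonal has a nonpositive sum with strictly
positive weights. So its trace vanishes, and with it the whole matrix. -/
theorem mul_self_eq_of_sum_eq {F : Matrix n n ℂ} (hF : F.PosSemidef) (hF' : (1 - F).PosSemidef)
    {v : n → ℝ} (hv : ∀ s, 0 < v s)
    (h : ∑ s, v s * (F s s).re ≤ ∑ s, v s * ((F * F) s s).re) : F * F = F := by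
  have hpsd := posSemidef_sub_mul_self hF hF'
  have hd : ∀ s, 0 ≤ ((F - F * F) s s).re := fun s =>
    (Complex.le_def.1 (hpsd.diag_nonneg (i := s))).1
  have h0 : ∑ s, v s * ((F - F * F) s s).re = 0 := by
    refine le_antisymm ?_ (Finset.sum_nonneg fun s _ => mul_nonneg (hv s).le (hd s))
    simp only [Matrix.sub_apply, Complex.sub_re, mul_sub, Finset.sum_sub_distrib]
    linarith
  have hz : ∀ s, (F - F * F) s s = 0 := by
    intro s
    have := (Finset.sum_eq_zero_iff_of_nonneg
      fun s _ => mul_nonneg (hv s).le (hd s)).1 h0 s (Finset.mem_univ s)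
    have hre := (mul_eq_zero.1 this).resolve_left (hv s).ne'
    exact Complex.ext hre (Complex.le_def.1 (hpsd.diag_nonneg (i := s))).2.symm
  have ht : (F - F * F).trace = 0 := Finset.sum_eq_zero fun s _ => hz s
  have := hpsd.trace_eq_zero_iff.1 ht
  exact (sub_eq_zero.1 this).symm

end Projections

/-! ### Projections of product form across each factor. -/

section Factor

variable {I : Type*} [Fintype I] [DecidableEq I] {κ : I → Type*} [∀ i, Fintype (κ i)]
  [∀ i, DecidableEq (κ i)]

/-- A matrix that is of product form across each tensor factor is of product form. -/
theorem apply_eq_mul_prod_of_factor {F : Matrix (∀ i, κ i) (∀ i, κ i) ℂ}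
    (hfac : ∀ i, ∃ (c : (∀ i, κ i) → (∀ i, κ i) → ℂ) (u : κ i → κ i → ℂ), ∀ t s x y,
      F (Function.update t i x) (Function.update s i y) = c t s * u x y)
    {s₀ : ∀ i, κ i} (h₀ : F s₀ s₀ ≠ 0) (t s : ∀ i, κ i) :
    F t s = F s₀ s₀ *
      ∏ i, F (Function.update s₀ i (t i)) (Function.update s₀ i (s i)) / F s₀ s₀ := by
  have key : ∀ S : Finset I, F (S.piecewise t s₀) (S.piecewise s s₀) = F s₀ s₀ *
      ∏ i ∈ S, F (Function.update s₀ i (t i)) (Function.update s₀ i (s i)) / F s₀ s₀ := by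
    intro S
    induction S using Finset.induction_on with
    | empty => simp
    | insert i S hi ih =>
      rw [Finset.piecewise_insert, Finset.piecewise_insert, Finset.prod_insert hi]
      obtain ⟨c, u, hcu⟩ := hfac i
      have e1 := hcu (S.piecewise t s₀) (S.piecewise s s₀) (s₀ i) (s₀ i)
      have u1 : ∀ r : (∀ i, κ i), Function.update (S.piecewise r s₀) i (s₀ i) = S.piecewise r s₀ := by
        intro r
        rw [Function.update_eq_self_iff]
        simp [hi]
      rw [u1, u1, ih] at e1
      have e2 := hcu s₀ s₀ (s₀ i) (s₀ i)
      rw [Function.update_eq_self] at e2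
      have hc : c s₀ s₀ ≠ 0 := fun h => h₀ (by rw [e2, h, zero_mul])
      have hu : u (s₀ i) (s₀ i) ≠ 0 := fun h => h₀ (by rw [e2, h, mul_zero])
      rw [hcu, hcu s₀ s₀]
      generalize (∏ i ∈ S, F (Function.update s₀ i (t i)) (Function.update s₀ i (s i)) / F s₀ s₀)
        = Q at e1 ⊢
      rw [e2] at e1 ⊢
      field_simp
      field_simp at e1
      rw [← e1]
      ring
  simpa using key Finset.univ

/-- A nonzero projection that is of product form across each tensor factor is a tensor product of
projections. -/
theorem exists_projections_of_factor {F : Matrix (∀ i, κ i) (∀ i, κ i) ℂ} (hF : F.PosSemidef)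
    (hFF : F * F = F) (hne : F ≠ 0)
    (hfac : ∀ i, ∃ (c : (∀ i, κ i) → (∀ i, κ i) → ℂ) (u : κ i → κ i → ℂ), ∀ t s x y,
      F (Function.update t i x) (Function.update s i y) = c t s * u x y) :
    ∃ Q : ∀ i, Matrix (κ i) (κ i) ℂ, (∀ i, (Q i).IsHermitian) ∧ (∀ i, Q i * Q i = Q i) ∧
      F = tensorMatrix Q := by
  obtain ⟨s₀, h₀⟩ : ∃ s₀, F s₀ s₀ ≠ 0 := by
    by_contra h
    push Not at h
    exact hne (hF.trace_eq_zero_iff.1 (Finset.sum_eq_zero fun s _ => h s))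
  have hherm := hF.isHermitian
  set c₀ := F s₀ s₀ with hc₀
  have hc₀star : star c₀ = c₀ := hherm.apply s₀ s₀
  let T : ∀ i, Matrix (κ i) (κ i) ℂ := fun i =>
    of fun x y => F (Function.update s₀ i x) (Function.update s₀ i y) / c₀
  have hT : ∀ i, (T i).IsHermitian := by
    intro i
    ext x y
    simp only [T, conjTranspose_apply, of_apply, star_div₀, hherm.apply, hc₀star]
  have hFT : F = c₀ • tensorMatrix T := by
    ext t s
    exact apply_eq_mul_prod_of_factor hfac h₀ t s
  have hT1 : ∀ i, T i (s₀ i) (s₀ i) = 1 := by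
    intro i
    simp only [T, of_apply, Function.update_eq_self]
    exact div_self h₀
  -- Comparing `F * F` with `F` while the other factors stay at `s₀`, where `T l` equals `1`, shows
  -- that `T i * T i` is proportional to `T i`; `γ i` rescales `T i` to an idempotent.
  let γ : I → ℂ := fun i => c₀ * ∏ l ∈ Finset.univ.erase i, (T l * T l) (s₀ l) (s₀ l)
  have hγ : ∀ i, γ i • (T i * T i) = T i := by
    intro i
    have h1 : c₀ • (tensorMatrix fun i => T i * T i) = tensorMatrix T := by
      have := hFF
      rw [hFT, smul_mul_assoc, mul_smul_comm, tensorMatrix_mul] at this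
      exact smul_right_injective _ h₀ this
    ext x y
    have h2 := congrFun (congrFun h1 (Function.update s₀ i x)) (Function.update s₀ i y)
    simp only [Matrix.smul_apply, tensorMatrix, of_apply, smul_eq_mul] at h2
    rw [← Finset.mul_prod_erase _ _ (Finset.mem_univ i),
      ← Finset.mul_prod_erase _ (fun l => T l _ _) (Finset.mem_univ i)] at h2
    have h3 : ∀ A : ∀ i, Matrix (κ i) (κ i) ℂ, ∏ l ∈ Finset.univ.erase i,
        A l (Function.update s₀ i x l) (Function.update s₀ i y l) =
        ∏ l ∈ Finset.univ.erase i, A l (s₀ l) (s₀ l) := by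
      intro A
      refine Finset.prod_congr rfl fun l hl => ?_
      rw [Function.update_of_ne (Finset.ne_of_mem_erase hl),
        Function.update_of_ne (Finset.ne_of_mem_erase hl)]
    rw [h3 (fun i => T i * T i), h3 T, Function.update_self, Function.update_self] at h2
    simp only [hT1, Finset.prod_const_one, mul_one] at h2
    rw [← h2]
    simp only [γ, Matrix.smul_apply, smul_eq_mul]
    ring
  have hTT : ∀ i, γ i * (T i * T i) (s₀ i) (s₀ i) = 1 := by
    intro i
    have := congrFun (congrFun (hγ i) (s₀ i)) (s₀ i)
    rwa [hT1, Matrix.smul_apply, smul_eq_mul] at this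
  have hγ0 : ∀ i, γ i ≠ 0 := fun i => left_ne_zero_of_mul_eq_one (hTT i)
  have hγstar : ∀ i, star (γ i) = γ i := by
    intro i
    have hr : star ((T i * T i) (s₀ i) (s₀ i)) = (T i * T i) (s₀ i) (s₀ i) := by
      have : (T i * T i).IsHermitian := by
        rw [IsHermitian, conjTranspose_mul, (hT i).eq]
      exact this.apply _ _
    have h1 := congrArg star (hTT i)
    rw [star_mul', hr, star_one, ← hTT i] at h1
    exact mul_right_cancel₀ (right_ne_zero_of_mul_eq_one (hTT i)) h1
  have hQQ : ∀ i, (γ i • T i) * (γ i • T i) = γ i • T i := by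
    intro i
    rw [smul_mul_assoc, mul_smul_comm, hγ]
  refine ⟨fun i => γ i • T i, fun i => ?_, hQQ, ?_⟩
  · rw [IsHermitian, conjTranspose_smul, hγstar, (hT i).eq]
  -- The product of the rescaled factors is a nonzero multiple `g • F` of `F`. Both are idempotent,
  -- so they coincide.
  · set g := (∏ i, γ i) / c₀ with hg
    have hgF : (tensorMatrix fun i => γ i • T i) = g • F := by
      rw [tensorMatrix_smul, hFT, smul_smul, hg, div_mul_cancel₀ _ h₀]
    have hg0 : g ≠ 0 := div_ne_zero (Finset.prod_ne_zero_iff.2 fun i _ => hγ0 i) h₀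
    have hsq : (tensorMatrix fun i => γ i • T i) * (tensorMatrix fun i => γ i • T i) =
        tensorMatrix fun i => γ i • T i := by
      rw [tensorMatrix_mul]
      simp only [hQQ]
    rw [hgF, smul_mul_assoc, mul_smul_comm, hFF] at hsq
    have h1 := smul_right_injective _ hg0 hsq
    rw [hgF, h1]

end Factor

/-! ### Marginals of product weights and equality of products of bounds. -/

section Marginal

variable {ι : Type*} [Fintype ι] [DecidableEq ι] {α : ι → Type*} [∀ i, Fintype (α i)]

theorem expect_comp_restrict {w : ∀ i, α i → ℝ} (hw : ∀ i, ∑ x, w i x = 1) (p : ι → Prop)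
    [DecidablePred p] (g : (∀ i : {i // p i}, α i) → ℝ) :
    expect w (fun a => g fun i => a i.1) =
      ∑ b : (∀ i : {i // p i}, α i), (∏ i, w i.1 (b i)) * g b := by
  rw [expect, ← Equiv.sum_comp (Equiv.piEquivPiSubtypeProd p α).symm, Fintype.sum_prod_type]
  refine Finset.sum_congr rfl fun b _ => ?_
  have h1 : ∀ c : (∀ i : {i // ¬ p i}, α i),
      (∏ i, w i ((Equiv.piEquivPiSubtypeProd p α).symm (b, c) i)) =
      (∏ i : {i // p i}, w i.1 (b i)) * ∏ i : {i // ¬ p i}, w i.1 (c i) := by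
    intro c
    rw [← Fintype.prod_subtype_mul_prod_subtype p]
    congr 1
    · exact Finset.prod_congr rfl fun i _ => by simp [Equiv.piEquivPiSubtypeProd, i.2]
    · exact Finset.prod_congr rfl fun i _ => by simp [Equiv.piEquivPiSubtypeProd, i.2]
  have h2 : ∀ c : (∀ i : {i // ¬ p i}, α i),
      (fun i : {i // p i} => (Equiv.piEquivPiSubtypeProd p α).symm (b, c) i.1) = b := by
    intro c
    funext i
    simp [Equiv.piEquivPiSubtypeProd, i.2]
  simp only [h1, h2, smul_eq_mul]
  rw [← Finset.sum_mul, ← Finset.mul_sum, ← prod_sum_pi fun (i : {i // ¬ p i}) x => w i.1 x]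
  simp [hw]

theorem norm_expect_prod_le {V : Type*} [Fintype V] [DecidableEq V] {w : ∀ i, α i → ℝ}
    (hw0 : ∀ i x, 0 ≤ w i x) (hw : ∀ i, ∑ x, w i x = 1) {k : V → (∀ i, α i) → ℂ} {s : V → Set ι}
    (hs : ∀ v, DependsOn (k v) (s v))
    (hi : ∀ i, ∃ v₁ v₂, v₁ ≠ v₂ ∧ ∀ v, i ∈ s v → v = v₁ ∨ v = v₂) :
    ‖expect w (fun a => ∏ v, k v a)‖ ≤ ∏ v, √(expect w (fun a => Complex.normSq (k v a))) := by
  refine (norm_expect_le hw0 _).trans ?_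
  simp only [norm_prod]
  exact expect_prod_sqrt_le (g := fun v a => Complex.normSq (k v a)) hw0 hw
    (fun v a => Complex.normSq_nonneg _) (fun v a b hab => congrArg Complex.normSq (hs v hab)) hi

theorem eq_of_prod_le_prod {V : Type*} [Fintype V] {f g : V → ℝ} (hf : ∀ v, 0 ≤ f v)
    (hfg : ∀ v, f v ≤ g v) (hpos : 0 < ∏ v, g v) (h : ∏ v, g v ≤ ∏ v, f v) (v : V) :
    f v = g v := by
  by_contra hne
  have hf' : ∀ v, 0 < f v := fun v => lt_of_le_of_ne (hf v) fun h0 => by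
    have : ∏ v, f v = 0 := Finset.prod_eq_zero (Finset.mem_univ v) h0.symm
    linarith
  exact absurd (Finset.prod_lt_prod (fun v _ => hf' v) (fun v _ => hfg v)
    ⟨v, Finset.mem_univ v, lt_of_le_of_ne (hfg v) hne⟩) h.not_gt

end Marginal

/-! ### The Finner equality case for networks of Schmidt-decomposed sources. -/

section Network

variable {N M : ℕ} {E : Fin N → Fin M → Bool}

theorem IsBipartite.exists_other (hbip : IsBipartite E) {i : Fin N} {j : Fin M} (h : E i j) :
    ∃ k, j ≠ k ∧ E i k ∧ ∀ l, E i l → l = j ∨ l = k := by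
  obtain ⟨a, b, hab, hu⟩ := Finset.card_eq_two.1 (Finset.card_univ.trans (hbip i))
  have hu' : ∀ l : {l // E i l}, l = a ∨ l = b := fun l => by simpa [hu] using Finset.mem_univ l
  have hab' : a.1 ≠ b.1 := fun e => hab (Subtype.ext e)
  have hu'' : ∀ l, E i l → l = a.1 ∨ l = b.1 := fun l hl =>
    (hu' ⟨l, hl⟩).imp (congrArg Subtype.val) (congrArg Subtype.val)
  rcases hu'' j h with rfl | rfl
  exacts [⟨b, hab', b.2, hu''⟩, ⟨a, hab'.symm, a.2, fun l hl => (hu'' l hl).symm⟩]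

theorem IsBipartite.exists_party (hbip : IsBipartite E) (i : Fin N) : ∃ j, E i j := by
  have : 0 < Fintype.card {j // E i j} := by rw [hbip i]; norm_num
  obtain ⟨j⟩ := Fintype.card_pos_iff.1 this
  exact ⟨j.1, j.2⟩

theorem IsBipartite.prod_prod (hbip : IsBipartite E) {R : Type*} [CommMonoid R] (g : Fin N → R) :
    ∏ j, ∏ i : {i // E i j}, g i.1 = ∏ i, g i ^ 2 := by
  rw [prod_cols (fun e => g e.1.1), ← prod_rows (fun e => g e.1.1)]
  refine Finset.prod_congr rfl fun i _ => ?_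
  exact (Finset.prod_const (g i)).trans (by rw [Finset.card_univ, hbip i])

/-- Equality in the Finner inequality for a network of pure states in their Schmidt bases. -/
theorem factor_of_schmidt_network (hbip : IsBipartite E) (hred : NoRedundantSource E)
    {r : Fin N → ℕ} {v : ∀ i, Fin (r i) → ℝ} (hv : ∀ i s, 0 < v i s) (hv1 : ∀ i, ∑ s, v i s = 1)
    {F : ∀ j, Matrix (∀ i : {i // E i j}, Fin (r i)) (∀ i : {i // E i j}, Fin (r i)) ℂ}
    (hF : ∀ j, (F j).PosSemidef) (hF' : ∀ j, (1 - F j).PosSemidef)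
    (hpos : 0 < √(∏ j, ∑ s, (∏ i : {i // E i j}, v i (s i)) * (F j s s).re))
    (hsat : √(∏ j, ∑ s, (∏ i : {i // E i j}, v i (s i)) * (F j s s).re) ≤
      ‖∑ d : (∀ i, Fin (r i) × Fin (r i)),
        (∏ i, ((√(v i (d i).1) * √(v i (d i).2) : ℝ) : ℂ)) *
          ∏ j, F j (fun i => (d i).2) (fun i => (d i).1)‖) (j : Fin M) :
    F j * F j = F j ∧ F j ≠ 0 ∧
      ∀ i : {i // E i j}, ∃ (c : (∀ i : {i // E i j}, Fin (r i)) → (∀ i : {i // E i j}, Fin (r i)) → ℂ)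
        (u : Fin (r i) → Fin (r i) → ℂ), ∀ t s x y,
          F j (Function.update t i x) (Function.update s i y) = c t s * u x y := by
  let c : ∀ i, Fin (r i) × Fin (r i) → ℝ := fun i q => √(v i q.1) * √(v i q.2)
  let w : ∀ i, Fin (r i) × Fin (r i) → ℝ := fun i q => v i q.1 * v i q.2
  have hc : ∀ i q, 0 < c i q := fun i q =>
    mul_pos (Real.sqrt_pos.2 (hv _ _)) (Real.sqrt_pos.2 (hv _ _))
  have hw0 : ∀ i q, 0 < w i q := fun i q => mul_pos (hv _ _) (hv _ _)
  have hwc : ∀ i q, w i q = c i q * c i q := by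
    intro i q
    simp only [w, c]
    rw [mul_mul_mul_comm, Real.mul_self_sqrt (hv _ _).le, Real.mul_self_sqrt (hv _ _).le]
  have hw : ∀ i, ∑ q, w i q = 1 := by
    intro i
    rw [Fintype.sum_prod_type]
    simp only [w, ← Finset.mul_sum, hv1, mul_one]
  let D : ∀ j, (∀ i : {i // E i j}, Fin (r i) × Fin (r i)) → ℝ := fun j b =>
    ∏ i : {i // E i j}, √(c i.1 (b i))
  have hD : ∀ j b, 0 < D j b := fun j b => Finset.prod_pos fun i _ => Real.sqrt_pos.2 (hc _ _)
  have hDD : ∀ j b, D j b * D j b = ∏ i, c i.1 (b i) := by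
    intro j b
    rw [← Finset.prod_mul_distrib]
    exact Finset.prod_congr rfl fun i _ => Real.mul_self_sqrt (hc _ _).le
  -- Every source has two ends, so the denominators multiply to `∏ i, c i`. As `w = c * c`, the
  -- division turns the coefficients `c` of the Born rule into the probability weights `w`.
  let k : Fin M → (∀ i, Fin (r i) × Fin (r i)) → ℂ := fun j a =>
    F j (fun i => (a i).2) (fun i => (a i).1) / (D j (fun i => a i) : ℂ)
  have hk : ∀ j, DependsOn (k j) {i | E i j} := by
    intro j a b hab
    have : (fun i : {i // E i j} => a i.1) = fun i : {i // E i j} => b i.1 :=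
      funext fun i => hab i.1 i.2
    have h2 := congrArg (fun f : (∀ i : {i // E i j}, Fin (r i) × Fin (r i)) =>
      F j (fun i => (f i).2) (fun i => (f i).1) / (D j f : ℂ)) this
    exact h2
  have hends : ∀ i, ∃ v₁ v₂, v₁ ≠ v₂ ∧ ∀ v, i ∈ {i | E i v = true} → v = v₁ ∨ v = v₂ := by
    intro i
    obtain ⟨j, hj⟩ := hbip.exists_party i
    obtain ⟨l, hl, -, h⟩ := hbip.exists_other hj
    exact ⟨j, l, hl, fun v hv => h v hv⟩
  have hz : expect w (fun a => ∏ j, k j a) = ∑ d : (∀ i, Fin (r i) × Fin (r i)),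
        (∏ i, ((√(v i (d i).1) * √(v i (d i).2) : ℝ) : ℂ)) *
          ∏ j, F j (fun i => (d i).2) (fun i => (d i).1) := by
    refine Finset.sum_congr rfl fun a _ => ?_
    have h1 : ∏ j, D j (fun i => a i) = ∏ i, c i (a i) := by
      simp only [D]
      rw [hbip.prod_prod fun i => √(c i (a i))]
      exact Finset.prod_congr rfl fun i _ => Real.sq_sqrt (hc _ _).le
    have h2 : ∏ i, c i (a i) ≠ 0 := Finset.prod_ne_zero_iff.2 fun i _ => (hc _ _).ne'
    simp only [k, Finset.prod_div_distrib]
    rw [← Complex.ofReal_prod, ← Complex.ofReal_prod, h1, Complex.real_smul]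
    simp only [hwc, Finset.prod_mul_distrib]
    push_cast
    have h3 : (∏ i, (c i (a i) : ℂ)) ≠ 0 := by exact_mod_cast h2
    rw [mul_div_assoc', div_eq_iff h3]
    simp only [c]
    push_cast
    simp only [Finset.prod_mul_distrib]
    ring
  let L : ∀ j, (∀ i : {i // E i j}, Fin (r i)) → ℝ := fun j s => ∏ i : {i // E i j}, v i (s i)
  have hL : ∀ j s, 0 < L j s := fun j s => Finset.prod_pos fun i _ => hv _ _
  have hEk : ∀ j, expect w (fun a => Complex.normSq (k j a)) =
      ∑ t, ∑ s, √(L j t) * √(L j s) * Complex.normSq (F j t s) := by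
    intro j
    have h1 := expect_comp_restrict hw (fun i => E i j = true)
      (fun b => Complex.normSq (F j (fun i => (b i).2) (fun i => (b i).1) / (D j b : ℂ)))
    refine h1.trans ?_
    rw [← Equiv.sum_comp (piProdEquiv _ _).symm, Fintype.sum_prod_type, Finset.sum_comm]
    refine Finset.sum_congr rfl fun t _ => Finset.sum_congr rfl fun s _ => ?_
    have hsq : ∀ s, √(L j s) = ∏ i : {i // E i j}, √(v i (s i)) := fun s =>
      Real.sqrt_prod _ fun i _ => (hv _ _).le
    simp only [map_div₀, Complex.normSq_ofReal, hDD, hwc, Finset.prod_mul_distrib]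
    have hne : ∏ i : {i // E i j}, c i.1 ((piProdEquiv _ _).symm (s, t) i) ≠ 0 :=
      Finset.prod_ne_zero_iff.2 fun i _ => (hc _ _).ne'
    rw [mul_div_assoc', mul_assoc, mul_div_assoc, mul_comm (∏ i : {i // E i j}, c i.1 _) (Complex.normSq _),
      mul_div_assoc, div_self hne, mul_one, hsq, hsq]
    congr 1
    rw [mul_comm, ← Finset.prod_mul_distrib]
    rfl
  let Q : Fin M → ℝ := fun j => ∑ s, L j s * (F j s s).re
  let S : Fin M → ℝ := fun j => ∑ s, L j s * ((F j * F j) s s).re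
  have hES : ∀ j, expect w (fun a => Complex.normSq (k j a)) ≤ S j := fun j => by
    rw [hEk]; exact sum_sqrt_mul_normSq_le (hF j) (hL j)
  have hSQ : ∀ j, S j ≤ Q j := fun j => sum_mul_re_mul_self_le (hF j) (hF' j) (hL j)
  have hE0 : ∀ j, 0 ≤ expect w (fun a => Complex.normSq (k j a)) := fun j =>
    expect_nonneg (fun i x => (hw0 i x).le) fun a => Complex.normSq_nonneg _
  have hQ0 : ∀ j, 0 ≤ Q j := fun j => (hE0 j).trans ((hES j).trans (hSQ j))
  have hprodQ : 0 < ∏ j, Q j := Real.sqrt_pos.1 hpos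
  have hchain := hsat
  rw [← hz] at hchain
  have hfin := norm_expect_prod_le (fun i x => (hw0 i x).le) hw hk hends
  rw [← Real.sqrt_prod _ fun j _ => hE0 j] at hfin
  -- Together with `hES` and `hSQ` this closes the cycle of inequalities, so each bound is attained
  -- separately for every party.
  have hle : ∏ j, Q j ≤ ∏ j, expect w (fun a => Complex.normSq (k j a)) :=
    (Real.sqrt_le_sqrt_iff (Finset.prod_nonneg fun j _ => hE0 j)).1 (hchain.trans hfin)
  have heq := eq_of_prod_le_prod hE0 (fun j => (hES j).trans (hSQ j)) hprodQ hle
  have hQpos : ∀ j, 0 < Q j := fun j => lt_of_le_of_ne (hQ0 j) fun h0 =>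
    hprodQ.ne' (Finset.prod_eq_zero (Finset.mem_univ j) h0.symm)
  refine ⟨mul_self_eq_of_sum_eq (hF j) (hF' j) (hL j) ((heq j).symm.le.trans (hES j)), ?_, ?_⟩
  · intro h0
    have := hQpos j
    simp [Q, h0] at this
  · rintro ⟨i, hi⟩
    obtain ⟨l, hjl, hil, huniq⟩ := hbip.exists_other hi
    have hprodE : ∏ j, √(expect w (fun a => Complex.normSq (k j a))) = √(∏ j, Q j) := by
      rw [← Real.sqrt_prod _ fun j _ => hE0 j]
      simp only [heq]
    obtain ⟨c', u, hcu⟩ := exists_factor_of_finner_eq (i₀ := i) hw0 hw hk hends hjl huniq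
      -- A second source `i'` joining `j` and `l` would make the source `i` redundant.
      (fun i' h1 h2 => by
        by_contra hne
        refine hred i i' (Ne.symm hne) fun l' hl' => ?_
        rcases huniq l' hl' with rfl | rfl
        exacts [h1, h2]) (hprodE ▸ hpos) (hprodE ▸ hchain)
    have hne : ∀ i, Nonempty (Fin (r i)) := by
      intro i
      by_contra h
      rw [not_nonempty_iff] at h
      have := hv1 i
      simp at this
    -- Pairs of indices at `j` are extended by arbitrary values at the sources that `j` does not
    -- see.
    let ext : (∀ i : {i // E i j}, Fin (r i)) → (∀ i : {i // E i j}, Fin (r i)) →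
        ∀ i, Fin (r i) × Fin (r i) := fun t s l =>
      if h : E l j then (s ⟨l, h⟩, t ⟨l, h⟩) else Classical.choice inferInstance
    have hext : ∀ t s x y, (fun l : {l // E l j} => Function.update (ext t s) i (y, x) l.1) =
        fun l => (Function.update s ⟨i, hi⟩ y l, Function.update t ⟨i, hi⟩ x l) := by
      intro t s x y
      funext l
      by_cases hl : l = ⟨i, hi⟩
      · subst hl; simp
      · have : l.1 ≠ i := fun e => hl (Subtype.ext e)
        rw [Function.update_of_ne this, Function.update_of_ne hl, Function.update_of_ne hl]
        simp only [ext, l.2, dif_pos]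
    -- The normalization `D j` is itself a product over the sources, so the product form of `k j`
    -- passes to `F j`.
    refine ⟨fun t s => c' (ext t s) *
        ((∏ l ∈ Finset.univ.erase (⟨i, hi⟩ : {i // E i j}), √(c l.1 (s l, t l)) : ℝ) : ℂ),
      fun x y => u (y, x) * (√(c i (y, x)) : ℂ), fun t s x y => ?_⟩
    have h1 := hcu (ext t s) (y, x)
    have h2 : k j (Function.update (ext t s) i (y, x)) =
        F j (Function.update t ⟨i, hi⟩ x) (Function.update s ⟨i, hi⟩ y) /
          (D j (fun l => (Function.update s ⟨i, hi⟩ y l, Function.update t ⟨i, hi⟩ x l)) : ℂ) :=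
      congrArg (fun f : (∀ i : {i // E i j}, Fin (r i) × Fin (r i)) =>
        F j (fun i => (f i).2) (fun i => (f i).1) / (D j f : ℂ)) (hext t s x y)
    have h3 : D j (fun l => (Function.update s ⟨i, hi⟩ y l, Function.update t ⟨i, hi⟩ x l)) =
        √(c i (y, x)) * ∏ l ∈ Finset.univ.erase (⟨i, hi⟩ : {i // E i j}), √(c l.1 (s l, t l)) := by
      simp only [D]
      rw [← Finset.mul_prod_erase _ _ (Finset.mem_univ (⟨i, hi⟩ : {i // E i j}))]
      simp only [Function.update_self]
      congr 1
      refine Finset.prod_congr rfl fun l hl => ?_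
      rw [Function.update_of_ne (Finset.ne_of_mem_erase hl),
        Function.update_of_ne (Finset.ne_of_mem_erase hl)]
    have h4 : (D j (fun l => (Function.update s ⟨i, hi⟩ y l, Function.update t ⟨i, hi⟩ x l)) : ℂ) ≠ 0 := by
      exact_mod_cast (hD j _).ne'
    rw [h2, div_eq_iff h4, h3] at h1
    rw [h1]
    push_cast
    ring

end Network

/-! ### The Born rule as a contraction, and its Schmidt form. -/

section Born

variable {N M : ℕ} {E : Fin N → Fin M → Bool} {dim : Fin N → Fin M → ℕ}

/-- The Born rule `tr[(⨂ i, ρ i) (⨂ j, X j)]` for arbitrary operators. -/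
def born (ρ : ∀ i, Matrix (∀ j : {j // E i j}, Fin (dim i j)) (∀ j : {j // E i j}, Fin (dim i j)) ℂ)
    (X : ∀ j, Matrix (∀ i : {i // E i j}, Fin (dim i j)) (∀ i : {i // E i j}, Fin (dim i j)) ℂ) :
    ℂ :=
  pairing (A := fun i j => Fin (dim i j) × Fin (dim i j))
    (fun i ξ => ρ i (fun j => (ξ j).1) (fun j => (ξ j).2))
    (fun j ξ => X j (fun i => (ξ i).2) (fun i => (ξ i).1))

theorem QuantumModel.prob_eq_born {O : Fin M → Type*} [∀ j, Fintype (O j)] (m : QuantumModel E O)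
    (a : ∀ j, O j) : m.prob a = (born m.state fun j => m.meas j (a j)).re := by
  rw [QuantumModel.prob, born, pairing, ← Equiv.sum_comp (piProdEquiv _ _).symm,
    Fintype.sum_prod_type, Matrix.trace]
  simp only [diag, mul_apply]
  rfl

variable (ρ : ∀ i, Matrix (∀ j : {j // E i j}, Fin (dim i j)) (∀ j : {j // E i j}, Fin (dim i j)) ℂ)

theorem sum_born {O : Fin M → Type*} [∀ j, Fintype (O j)] (X : ∀ j, O j →
    Matrix (∀ i : {i // E i j}, Fin (dim i j)) (∀ i : {i // E i j}, Fin (dim i j)) ℂ) :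
    ∑ a : (∀ j, O j), born ρ (fun j => X j (a j)) = born ρ (fun j => ∑ o, X j o) := by
  simp only [born, Matrix.sum_apply]
  exact sum_pairing (A := fun i j => Fin (dim i j) × Fin (dim i j))
    (fun i ξ => ρ i (fun j => (ξ j).1) (fun j => (ξ j).2))
    fun j o ξ => X j o (fun i => (ξ i).2) (fun i => (ξ i).1)

theorem born_smul (c : Fin N → ℂ)
    (X : ∀ j, Matrix (∀ i : {i // E i j}, Fin (dim i j)) (∀ i : {i // E i j}, Fin (dim i j)) ℂ) :
    born (fun i => c i • ρ i) X = (∏ i, c i) * born ρ X := by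
  simp only [born, pairing, Matrix.smul_apply, smul_eq_mul, Finset.prod_mul_distrib,
    Finset.mul_sum, mul_assoc]

theorem born_eq_zero
    {X : ∀ j, Matrix (∀ i : {i // E i j}, Fin (dim i j)) (∀ i : {i // E i j}, Fin (dim i j)) ℂ}
    {j : Fin M} (h : X j = 0) : born ρ X = 0 := by
  refine Finset.sum_eq_zero fun ξ _ => ?_
  rw [Finset.prod_eq_zero (Finset.mem_univ j) (by simp only [h]; rfl), mul_zero]

theorem born_one : born ρ (fun _ => 1) = ∏ i, (ρ i).trace := by
  have h1 : ∀ i, (ρ i).trace = ∑ ξ : (∀ j : {j // E i j}, Fin (dim i j) × Fin (dim i j)),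
      ρ i (fun j => (ξ j).1) (fun j => (ξ j).2) *
        ∏ j : {j // E i j}, if (ξ j).2 = (ξ j).1 then 1 else 0 := by
    intro i
    rw [← Equiv.sum_comp (piProdEquiv _ _).symm, Fintype.sum_prod_type, Matrix.trace]
    refine Finset.sum_congr rfl fun x _ => ?_
    simp only [piProdEquiv, Equiv.coe_fn_symm_mk]
    rw [Finset.sum_eq_single x, diag]
    · simp
    · intro y _ hy
      obtain ⟨j, hj⟩ := Function.ne_iff.1 hy
      rw [Finset.prod_eq_zero (Finset.mem_univ j) (if_neg hj), mul_zero]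
    · simp
  simp only [h1]
  rw [prod_sum_rows (A := fun i j => Fin (dim i j) × Fin (dim i j))]
  refine Finset.sum_congr rfl fun ξ _ => ?_
  rw [Finset.prod_mul_distrib]
  congr 1
  rw [prod_rows (fun e => if (ξ e).2 = (ξ e).1 then (1 : ℂ) else 0),
    ← prod_cols (fun e => if (ξ e).2 = (ξ e).1 then (1 : ℂ) else 0)]
  refine Finset.prod_congr rfl fun j _ => ?_
  rw [Fintype.prod_boole]
  simp only [one_apply, funext_iff]

/-- Passage to the Heisenberg picture: local operators acting on the states act dually on the
measurements. -/
theorem born_conj (K : ∀ i (j : {j // E i j}), Matrix (Fin (dim i j)) (Fin (dim i j)) ℂ)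
    (X : ∀ j, Matrix (∀ i : {i // E i j}, Fin (dim i j)) (∀ i : {i // E i j}, Fin (dim i j)) ℂ) :
    born (fun i => tensorMatrix (K i) * ρ i * (tensorMatrix (K i))ᴴ) X =
      born ρ (fun j => (tensorMatrix fun i : {i // E i j} => K i.1 ⟨j, i.2⟩)ᴴ * X j *
        tensorMatrix fun i : {i // E i j} => K i.1 ⟨j, i.2⟩) := by
  have h := pairing_transport (A := fun i j => Fin (dim i j) × Fin (dim i j))
    (A' := fun i j => Fin (dim i j) × Fin (dim i j))
    (fun i j ξ η => K i j ξ.1 η.1 * star (K i j ξ.2 η.2))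
    (fun i ξ => ρ i (fun j => (ξ j).1) (fun j => (ξ j).2))
    (fun j ξ => X j (fun i => (ξ i).2) (fun i => (ξ i).1))
  unfold born
  convert h using 2
  · funext i ξ
    rw [← Equiv.sum_comp (piProdEquiv _ _).symm, Fintype.sum_prod_type, Finset.sum_comm]
    refine (mul_apply ..).trans ?_
    refine Finset.sum_congr rfl fun t _ => ?_
    rw [mul_apply, Finset.sum_mul]
    refine Finset.sum_congr rfl fun s _ => ?_
    simp only [conjTranspose_apply, tensorMatrix, of_apply, piProdEquiv, Equiv.coe_fn_symm_mk,
      Finset.prod_mul_distrib, star_prod]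
    ring
  · funext j η
    have := compress_apply (P := fun _ => Unit)
      (fun (i : {i // E i j}) (_ : Unit) => K i.1 ⟨j, i.2⟩) (X j) (fun i => (η i).2)
      (fun i => (η i).1)
    simpa [compress] using this

/-- The Born rule in terms of Schmidt decompositions of the sources. -/
theorem born_eq_sum_compress {P : Fin N → Type} [∀ i, Fintype (P i)] {near : ∀ i, {j // E i j}}
    {r : Fin N → ℕ} {v : ∀ i, Fin (r i) → ℝ}
    {B : ∀ i (j : {j // E i j}), P i → Matrix (Fin (dim i j)) (Fin (r i)) ℂ}
    (hS : ∀ i, IsSchmidt (ρ i) (near i) (v i) (B i))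
    (X : ∀ j, Matrix (∀ i : {i // E i j}, Fin (dim i j)) (∀ i : {i // E i j}, Fin (dim i j)) ℂ) :
    born ρ X = ∑ d : (∀ i, Fin (r i) × Fin (r i)),
      (∏ i, ((√(v i (d i).1) * √(v i (d i).2) : ℝ) : ℂ)) *
        ∏ j, compress (fun i : {i // E i j} => B i.1 ⟨j, i.2⟩) (X j)
          (fun i => (d i).2) (fun i => (d i).1) := by
  have h := pairing_eq_sum (A := fun i j => Fin (dim i j) × Fin (dim i j))
    (D := fun i => Fin (r i) × Fin (r i))
    (fun i j ξ q => ∑ p, B i j p ξ.1 q.1 * star (B i j p ξ.2 q.2))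
    (fun i q => ((√(v i q.1) * √(v i q.2) : ℝ) : ℂ))
    (fun j ξ => X j (fun i => (ξ i).2) (fun i => (ξ i).1))
  simp only [compress_apply]
  rw [← h, born]
  congr 1
  funext i ξ
  exact (hS i).eq_sum _ _

/-- The marginal at party `k`, in terms of Schmidt decompositions of the sources. -/
theorem re_born_marginal (hbip : IsBipartite E) {P : Fin N → Type} [∀ i, Fintype (P i)]
    {near : ∀ i, {j // E i j}} {r : Fin N → ℕ} {v : ∀ i, Fin (r i) → ℝ}
    {B : ∀ i (j : {j // E i j}), P i → Matrix (Fin (dim i j)) (Fin (r i)) ℂ}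
    (hS : ∀ i, IsSchmidt (ρ i) (near i) (v i) (B i))
    {X : ∀ j, Matrix (∀ i : {i // E i j}, Fin (dim i j)) (∀ i : {i // E i j}, Fin (dim i j)) ℂ}
    {k : Fin M} (hX : ∀ j, j ≠ k → X j = 1) :
    (born ρ X).re = ∑ s, (∏ i : {i // E i k}, v i (s i)) *
      (compress (fun i : {i // E i k} => B i.1 ⟨k, i.2⟩) (X k) s s).re := by
  have hone : ∀ j, j ≠ k → compress (fun i : {i // E i j} => B i.1 ⟨j, i.2⟩) (X j) = 1 :=
    fun j hj => by rw [hX j hj]; exact compress_one fun i => (hS i.1).isometry _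
  rw [born_eq_sum_compress ρ hS, ← expect_comp_restrict (fun i => (hS i).sum_eq_one)
    (fun i => E i k = true)
    (fun s => (compress (fun i : {i // E i k} => B i.1 ⟨k, i.2⟩) (X k) s s).re),
    ← Equiv.sum_comp (piProdEquiv _ _).symm, Fintype.sum_prod_type, Complex.re_sum]
  refine Finset.sum_congr rfl fun s _ => ?_
  simp only [piProdEquiv, Equiv.coe_fn_symm_mk]
  rw [Finset.sum_eq_single s]
  · rw [← Finset.mul_prod_erase _ _ (Finset.mem_univ k)]
    rw [Finset.prod_eq_one (s := Finset.univ.erase k) fun j hj => by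
      rw [hone j (Finset.ne_of_mem_erase hj), one_apply_eq]]
    simp only [mul_one, Real.mul_self_sqrt ((hS _).pos _).le]
    rw [← Complex.ofReal_prod, Complex.re_ofReal_mul, smul_eq_mul]
  -- Each source has an end other than `k`; the identity effect there kills the terms with different
  -- ket and bra indices.
  · intro t _ hts
    obtain ⟨i, hi⟩ := Function.ne_iff.1 hts
    obtain ⟨j, hj⟩ := hbip.exists_party i
    obtain ⟨l, hjl, hil, -⟩ := hbip.exists_other hj
    obtain ⟨q, hq, hiq⟩ : ∃ q, q ≠ k ∧ E i q := by
      by_cases h : j = k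
      · exact ⟨l, fun e => hjl (h.trans e.symm), hil⟩
      · exact ⟨j, h, hj⟩
    rw [Finset.prod_eq_zero (Finset.mem_univ q), mul_zero]
    rw [hone q hq, one_apply_ne]
    exact fun e => hi (congrFun e ⟨i, hiq⟩)
  · simp

end Born

/-! ### Conclusive effects and the probabilities of conclusive outcomes. -/

section Conclusive

variable {N M : ℕ} {E : Fin N → Fin M → Bool} {O : Fin M → Type*} [∀ j, Fintype (O j)]
  (m : QuantumModel E (fun j => Option (O j)))

/-- The effect of a conclusive outcome of party `j`. -/
def QuantumModel.conclusive (j : Fin M) :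
    Matrix (∀ i : {i // E i j}, Fin (m.dim i j)) (∀ i : {i // E i j}, Fin (m.dim i j)) ℂ :=
  ∑ a : O j, m.meas j (some a)

theorem QuantumModel.conclusive_posSemidef (j : Fin M) : (m.conclusive j).PosSemidef :=
  posSemidef_sum _ fun _ _ => (m.isPOVM j).posSemidef _

theorem QuantumModel.meas_none (j : Fin M) : m.meas j none = 1 - m.conclusive j := by
  have := (m.isPOVM j).sum_eq_one
  rw [Fintype.sum_option] at this
  exact eq_sub_of_add_eq this

/-- The event is an intersection of conditions on single parties, so by multilinearity each party
may sum its effects separately. -/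
theorem QuantumModel.sum_ite_prob (q : ∀ j, Option (O j) → Prop) [∀ j o, Decidable (q j o)] :
    (∑ a, if ∀ j, q j (a j) then m.prob a else 0) =
      (born m.state fun j => ∑ o, if q j o then m.meas j o else 0).re := by
  rw [← sum_born m.state (fun j o => if q j o then m.meas j o else 0), Complex.re_sum]
  refine Finset.sum_congr rfl fun a _ => ?_
  split_ifs with h
  · simp only [h, if_true, m.prob_eq_born]
  · push Not at h
    obtain ⟨j, hj⟩ := h
    rw [born_eq_zero m.state (j := j) (by simp [hj]), Complex.zero_re]

theorem QuantumModel.probAllConclusive_eq :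
    probAllConclusive m.prob = (born m.state m.conclusive).re := by
  rw [probAllConclusive, m.sum_ite_prob fun j o => o.isSome = true]
  congr 2
  funext j
  simp [Fintype.sum_option, conclusive]

theorem QuantumModel.probConclusive_eq (k : Fin M) :
    probConclusive m.prob k =
      (born m.state fun j => if j = k then m.conclusive j else 1).re := by
  have h := m.sum_ite_prob fun j o => j = k → o.isSome = true
  simp only [forall_eq] at h
  rw [probConclusive, h]
  congr 2
  funext j
  by_cases hj : j = k
  · simp [hj, Fintype.sum_option, conclusive]
  · simpa [hj] using (m.isPOVM j).sum_eq_one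

end Conclusive

/-! ### Independence of the orthonormal basis chosen for a support. -/

section Support

variable {n : Type*} [Fintype n] [DecidableEq n]

theorem isSupportBasis_of_eq {r : ℕ} {ρ : Matrix n n ℂ} {U : Matrix n (Fin r) ℂ} {v : Fin r → ℝ}
    (hv : ∀ s, 0 < v s) (hU : Uᴴ * U = 1) (h : ρ = U * diagonal (fun s => (v s : ℂ)) * Uᴴ) :
    IsSupportBasis ρ U := by
  refine ⟨hU, le_antisymm ?_ ?_⟩
  · rintro _ ⟨x, rfl⟩
    refine ⟨(U * diagonal (fun s => ((v s : ℂ))⁻¹)) *ᵥ x, ?_⟩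
    have hd : diagonal (fun s => (v s : ℂ)) * diagonal (fun s => ((v s : ℂ))⁻¹) = 1 := by
      rw [diagonal_mul_diagonal, ← diagonal_one]
      congr 1
      funext s
      exact mul_inv_cancel₀ (by exact_mod_cast (hv s).ne')
    have : ρ * (U * diagonal (fun s => ((v s : ℂ))⁻¹)) = U := by
      rw [h]
      calc _ = U * (diagonal (fun s => (v s : ℂ)) * (Uᴴ * U) *
            diagonal (fun s => ((v s : ℂ))⁻¹)) := by simp only [Matrix.mul_assoc]
        _ = U := by rw [hU, Matrix.mul_one, hd, Matrix.mul_one]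
    rw [mulVecLin_apply, mulVecLin_apply, mulVec_mulVec, this]
  · rintro _ ⟨x, rfl⟩
    refine ⟨(diagonal (fun s => (v s : ℂ)) * Uᴴ) *ᵥ x, ?_⟩
    rw [mulVecLin_apply, mulVecLin_apply, mulVec_mulVec, h, Matrix.mul_assoc]

theorem IsSupportBasis.mul_conjTranspose_mul {r r' : ℕ} {ρ : Matrix n n ℂ} {U : Matrix n (Fin r) ℂ}
    {V : Matrix n (Fin r') ℂ} (hU : IsSupportBasis ρ U) (hV : IsSupportBasis ρ V) :
    V * Vᴴ * U = U := by
  have key : ∀ x, V *ᵥ (Vᴴ *ᵥ (U *ᵥ x)) = U *ᵥ x := by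
    intro x
    have : U *ᵥ x ∈ LinearMap.range V.mulVecLin := by
      rw [hV.range_eq, ← hU.range_eq]
      exact ⟨x, rfl⟩
    obtain ⟨y, hy⟩ := this
    rw [← hy, mulVecLin_apply, mulVec_mulVec y, hV.isometry, one_mulVec]
  refine Matrix.ext_of_mulVec_single fun i => ?_
  rw [← mulVec_mulVec, ← mulVec_mulVec, key]

/-- Both sides are the orthogonal projection onto the support. This transfers results from the
Schmidt basis to an arbitrary one. -/
theorem IsSupportBasis.mul_conjTranspose_eq {r r' : ℕ} {ρ : Matrix n n ℂ} {U : Matrix n (Fin r) ℂ}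
    {V : Matrix n (Fin r') ℂ} (hU : IsSupportBasis ρ U) (hV : IsSupportBasis ρ V) :
    U * Uᴴ = V * Vᴴ := by
  have h1 : V * Vᴴ * (U * Uᴴ) = U * Uᴴ := by
    rw [← Matrix.mul_assoc, hU.mul_conjTranspose_mul hV]
  have h2 : U * Uᴴ * (V * Vᴴ) = V * Vᴴ := by
    rw [← Matrix.mul_assoc, hV.mul_conjTranspose_mul hU]
  have h3 := congrArg conjTranspose h1
  simp only [conjTranspose_mul, conjTranspose_conjTranspose] at h3
  rw [← h3, h2]

end Support

/-! ### POVMs behind effects that add up to a projection. -/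

section Povm

open scoped MatrixOrder

variable {n : Type*} [Fintype n] [DecidableEq n]

/-- A vanishing sum of positive semidefinite terms has vanishing terms, and with `A a = Cᴴ * C` the
term at `a` is `(C * R)ᴴ * (C * R)`, so `C * R = 0`. -/
theorem mul_eq_zero_of_sum_conj_eq_zero {O : Type*} [Fintype O] {A : O → Matrix n n ℂ}
    (hA : ∀ a, (A a).PosSemidef) {R : Matrix n n ℂ} (h : ∑ a, Rᴴ * A a * R = 0) (a : O) :
    A a * R = 0 := by
  obtain ⟨C, hC⟩ := CStarAlgebra.nonneg_iff_eq_star_mul_self.1 (hA a).nonneg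
  rw [star_eq_conjTranspose] at hC
  have hps : ∀ a, (Rᴴ * A a * R).PosSemidef := fun a => (hA a).conjTranspose_mul_mul_same R
  have ht : ∑ a, (Rᴴ * A a * R).trace = 0 := by
    rw [← Matrix.trace_sum, h, Matrix.trace_zero]
  have h0 := (Finset.sum_eq_zero_iff_of_nonneg fun a _ => (hps a).trace_nonneg).1 ht a
    (Finset.mem_univ a)
  have h1 := (hps a).trace_eq_zero_iff.1 h0
  have h2 : (C * R)ᴴ * (C * R) = 0 := by
    rw [conjTranspose_mul, ← h1, hC]
    simp only [Matrix.mul_assoc]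
  rw [conjTranspose_mul_self_eq_zero] at h2
  rw [hC, Matrix.mul_assoc, h2, Matrix.mul_zero]

/-- Effects that add up to a projection are obtained by measuring a POVM after projecting. -/
theorem exists_povm_of_sum_eq_projection {O : Type*} [Fintype O] [Nonempty O]
    {A : O → Matrix n n ℂ} (hA : ∀ a, (A a).PosSemidef) {Q : Matrix n n ℂ} (hQ : Q.IsHermitian)
    (hQQ : Q * Q = Q) (hsum : ∑ a, A a = Q) :
    ∃ G : O → Matrix n n ℂ, IsPOVM G ∧ ∀ a, A a = Qᴴ * G a * Q := by
  classical
  let o : O := Classical.arbitrary O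
  have hR : (1 - Q)ᴴ = 1 - Q := by rw [conjTranspose_sub, conjTranspose_one, hQ.eq]
  have hR0 : (1 - Q) * Q = 0 := by rw [Matrix.sub_mul, Matrix.one_mul, hQQ, sub_self]
  have hAR : ∀ a, A a * (1 - Q) = 0 := by
    refine mul_eq_zero_of_sum_conj_eq_zero hA ?_
    rw [← Finset.sum_mul, ← Finset.mul_sum, hsum, hR, hR0, Matrix.zero_mul]
  have hAQ : ∀ a, A a * Q = A a := fun a => by
    have := hAR a
    rw [Matrix.mul_sub, Matrix.mul_one, sub_eq_zero] at this
    exact this.symm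
  have hQA : ∀ a, Q * A a = A a := fun a => by
    have := congrArg conjTranspose (hAQ a)
    rwa [conjTranspose_mul, hQ.eq, (hA a).isHermitian.eq] at this
  have hRpsd : (1 - Q).PosSemidef := by
    have : 1 - Q = (1 - Q)ᴴ * (1 - Q) := by
      rw [hR, Matrix.mul_sub, hR0, Matrix.mul_one, sub_zero]
    rw [this]
    exact posSemidef_conjTranspose_mul_self _
  -- The complement `1 - Q` is given to an arbitrary outcome `o`; it is invisible after projecting
  -- by `Q`.
  refine ⟨fun a => A a + if a = o then 1 - Q else 0, ⟨fun a => ?_, ?_⟩, fun a => ?_⟩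
  · split_ifs
    · exact (hA a).add hRpsd
    · simpa using hA a
  · rw [Finset.sum_add_distrib, hsum, Finset.sum_ite_eq']
    simp
  · rw [hQ.eq, Matrix.mul_add, Matrix.add_mul, hQA, hAQ]
    split_ifs
    · rw [Matrix.mul_assoc, hR0, Matrix.mul_zero, add_zero]
    · simp

end Povm

/-! ### Projections as local filters. -/

section Filter

variable {n : Type*} [Fintype n] [DecidableEq n]

/-- The map `X ↦ K X Kᴴ`. -/
def conjMap (K : Matrix n n ℂ) : Matrix n n ℂ →ₗ[ℂ] Matrix n n ℂ where
  toFun X := K * X * Kᴴ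
  map_add' X Y := by rw [Matrix.mul_add, Matrix.add_mul]
  map_smul' c X := by simp

/-- Complete positivity: the amplified map is conjugation by `K ⊗ 1`. Trace: the loss is the trace
of `(1 - K) * X * (1 - K)`, which is nonnegative. -/
theorem isFilter_conjMap {K : Matrix n n ℂ} (hK : K.IsHermitian) (hKK : K * K = K) :
    IsFilter (conjMap K) := by
  refine ⟨fun k X hX => ?_, fun X hX => ?_⟩
  · let L : Matrix (n × Fin k) (n × Fin k) ℂ :=
      of fun p q => if p.2 = q.2 then K p.1 q.1 else 0
    convert hX.mul_mul_conjTranspose_same L using 1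
    ext p q
    simp only [conjMap, LinearMap.coe_mk, AddHom.coe_mk, of_apply, mul_apply, conjTranspose_apply, L,
      Fintype.sum_prod_type, ite_mul, zero_mul, Finset.sum_ite_eq, Finset.mem_univ, if_true]
    refine Finset.sum_congr rfl fun b _ => ?_
    rw [Finset.sum_eq_single q.2]
    · simp
    · intro c _ hc
      simp [Ne.symm hc]
    · simp
  · have hR : (1 - K)ᴴ = 1 - K := by rw [conjTranspose_sub, conjTranspose_one, hK.eq]
    have h1 := (hX.conjTranspose_mul_mul_same (1 - K)).trace_nonneg
    have h2 : ((1 - K)ᴴ * X * (1 - K)).trace = X.trace - (conjMap K X).trace := by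
      have hRR : (1 - K) * (1 - K) = 1 - K := by
        rw [Matrix.sub_mul, Matrix.one_mul, Matrix.mul_sub, Matrix.mul_one, hKK, sub_self, sub_zero]
      rw [hR, Matrix.trace_mul_comm, ← Matrix.mul_assoc, hRR, Matrix.sub_mul, Matrix.one_mul,
        Matrix.trace_sub]
      congr 1
      change _ = (K * X * Kᴴ).trace
      rw [hK.eq, Matrix.trace_mul_comm (K * X), ← Matrix.mul_assoc, hKK]
    rw [h2] at h1
    have := (Complex.le_def.1 h1).1
    simpa using this

theorem adjointMap_conjMap (K Y : Matrix n n ℂ) : adjointMap (conjMap K) Y = Kᴴ * Y * K := by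
  have h : ∀ X, (X * adjointMap (conjMap K) Y).trace = (X * (Kᴴ * Y * K)).trace := by
    intro X
    rw [trace_mul_adjointMap]
    change (K * X * Kᴴ * Y).trace = _
    rw [Matrix.mul_assoc, Matrix.mul_assoc, Matrix.trace_mul_comm]
    simp only [Matrix.mul_assoc]
  ext a b
  have := h (Matrix.single b a 1)
  simpa [Matrix.trace_single_mul] using this

variable {ι : Type*} [Fintype ι] [DecidableEq ι] {κ : ι → Type*} [∀ i, Fintype (κ i)]
  [∀ i, DecidableEq (κ i)]

theorem tensorMap_conjMap (K : ∀ i, Matrix (κ i) (κ i) ℂ) :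
    tensorMap (fun i => conjMap (K i)) = conjMap (tensorMatrix K) := by
  refine LinearMap.ext fun X => ?_
  ext x y
  have h : ∀ (i : ι) (a b c d : κ i), conjMap (K i) (Matrix.single a b 1) c d =
      K i c a * star (K i d b) := by
    intro i a b c d
    change (K i * Matrix.single a b (1 : ℂ) * (K i)ᴴ : Matrix (κ i) (κ i) ℂ) c d = _
    rw [mul_apply, Finset.sum_eq_single b]
    · simp
    · intro e _ he
      rw [Matrix.mul_single_apply_of_ne _ _ _ _ _ he, zero_mul]
    · simp
  simp only [tensorMap, LinearMap.sum_apply, LinearMap.smulRight_apply, Matrix.sum_apply,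
    Matrix.entryLinearMap_apply, Matrix.smul_apply, smul_eq_mul, tensorMatrix, of_apply, h]
  change _ = (tensorMatrix K * X * (tensorMatrix K)ᴴ) x y
  rw [mul_apply, Finset.sum_comm]
  refine Finset.sum_congr rfl fun b _ => ?_
  rw [mul_apply, Finset.sum_mul]
  refine Finset.sum_congr rfl fun a _ => ?_
  simp only [conjTranspose_apply, tensorMatrix, of_apply, Finset.prod_mul_distrib, star_prod]
  ring

end Filter

/-! ### Local projections at each party, fair sampling and the post-selected model. -/

section Party

theorem compress_of_single {I : Type*} [Fintype I] [DecidableEq I] {κ μ P : I → Type*}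
    [∀ i, Fintype (κ i)] [∀ i, DecidableEq (κ i)] [∀ i, Fintype (μ i)] [∀ i, DecidableEq (μ i)]
    [∀ i, Fintype (P i)] {B : ∀ i, P i → Matrix (κ i) (μ i) ℂ} {p₀ : ∀ i, P i}
    (hB : ∀ i p, p ≠ p₀ i → B i p = 0) (X : Matrix (∀ i, κ i) (∀ i, κ i) ℂ) :
    compress B X =
      (tensorMatrix fun i => B i (p₀ i))ᴴ * X * tensorMatrix fun i => B i (p₀ i) := by
  refine Finset.sum_eq_single p₀ (fun p _ hp => ?_) (fun h => absurd (Finset.mem_univ _) h)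
  obtain ⟨i, hi⟩ := Function.ne_iff.1 hp
  have : (tensorMatrix fun i => B i (p i)) = 0 := by
    ext x y
    exact Finset.prod_eq_zero (Finset.mem_univ i) (by simp only [hB i _ hi]; rfl)
  rw [this, Matrix.mul_zero]

theorem projection_conj {n l : Type*} [Fintype n] [DecidableEq n] [Fintype l] [DecidableEq l]
    {W : Matrix n l ℂ} (hW : Wᴴ * W = 1) {Q : Matrix l l ℂ} (hQ : Q.IsHermitian)
    (hQQ : Q * Q = Q) : (W * Q * Wᴴ).IsHermitian ∧ (W * Q * Wᴴ) * (W * Q * Wᴴ) = W * Q * Wᴴ := by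
  refine ⟨isHermitian_mul_mul_conjTranspose W hQ, ?_⟩
  calc _ = W * (Q * (Wᴴ * W) * Q) * Wᴴ := by simp only [Matrix.mul_assoc]
    _ = _ := by rw [hW, Matrix.mul_one, hQQ]

variable {N M : ℕ} {E : Fin N → Fin M → Bool} {O : Fin M → Type*} [∀ j, Fintype (O j)]
  (m : QuantumModel E (fun j => Option (O j)))

/-- `U i` are bases of the supports of the systems received by party `j`, and the conclusive effect
of the party restricts to the product of the projections `Q i` on the supports. -/
structure IsLocalProjection (j : Fin M) {r : {i // E i j} → ℕ}
    (U : ∀ i : {i // E i j}, Matrix (Fin (m.dim i j)) (Fin (r i)) ℂ)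
    (Q : ∀ i : {i // E i j}, Matrix (Fin (r i)) (Fin (r i)) ℂ) : Prop where
  support : ∀ i, IsSupportBasis (m.reducedState i.1 ⟨j, i.2⟩) (U i)
  isHermitian : ∀ i, (Q i).IsHermitian
  mul_self : ∀ i, Q i * Q i = Q i
  conclusive_eq : (tensorMatrix U)ᴴ * m.conclusive j * tensorMatrix U = tensorMatrix Q
  -- The Born rule sees the operator of party `j` only through its compression to the supports.
  born_congr : ∀ X Y, (∀ l, l ≠ j → X l = Y l) →
    (tensorMatrix U)ᴴ * X j * tensorMatrix U = (tensorMatrix U)ᴴ * Y j * tensorMatrix U →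
    born m.state X = born m.state Y

theorem exists_isLocalProjection (hbip : IsBipartite E) (hred : NoRedundantSource E)
    (hpos : 0 < probAllConclusive m.prob) (hsat : SaturatesFinner m.prob) (j₀ : Fin M) :
    ∃ (r : {i // E i j₀} → ℕ) (U : ∀ i : {i // E i j₀}, Matrix (Fin (m.dim i j₀)) (Fin (r i)) ℂ)
      (Q : ∀ i : {i // E i j₀}, Matrix (Fin (r i)) (Fin (r i)) ℂ), IsLocalProjection m j₀ U Q := by
  -- At the sources of `j₀` the purifying system goes to the other party, so the Schmidt vectors of
  -- `j₀` lie in the systems it receives. At the remaining sources the choice is immaterial.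
  let near : ∀ i, {j // E i j} := fun i =>
    if h : E i j₀ then ⟨j₀, h⟩ else ⟨_, (hbip.exists_party i).choose_spec⟩
  have hnear : ∀ i : {i // E i j₀}, near i.1 = ⟨j₀, i.2⟩ := fun i => dif_pos i.2
  choose r v B hS using fun i => exists_isSchmidt (hbip i) (m.isDensity i) (near i)
  let F : ∀ j, Matrix (∀ i : {i // E i j}, Fin (r i)) (∀ i : {i // E i j}, Fin (r i)) ℂ := fun j =>
    compress (fun i : {i // E i j} => B i.1 ⟨j, i.2⟩) (m.conclusive j)
  have hF : ∀ j, (F j).PosSemidef := fun j => compress_posSemidef _ (m.conclusive_posSemidef j)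
  have hF' : ∀ j, (1 - F j).PosSemidef := fun j => by
    rw [← compress_one (B := fun i : {i // E i j} => B i.1 ⟨j, i.2⟩)
      fun i => (hS i.1).isometry _, ← compress_sub, ← m.meas_none]
    exact compress_posSemidef _ ((m.isPOVM j).posSemidef _)
  have hmarg : ∀ j, probConclusive m.prob j =
      ∑ s, (∏ i : {i // E i j}, v i (s i)) * (F j s s).re := fun j => by
    rw [m.probConclusive_eq, re_born_marginal m.state hbip hS (k := j)
      fun l hl => if_neg hl]
    simp only [if_true, F]
  have hall := m.probAllConclusive_eq
  rw [born_eq_sum_compress m.state hS] at hall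
  have hsat' : probAllConclusive m.prob = √(∏ j, probConclusive m.prob j) := hsat
  simp only [hmarg] at hsat'
  obtain ⟨hFF, hF0, hfac⟩ := factor_of_schmidt_network hbip hred (fun i => (hS i).pos)
    (fun i => (hS i).sum_eq_one) hF hF' (hsat' ▸ hpos)
    ((hsat'.symm.trans hall).le.trans (Complex.re_le_norm _)) j₀
  obtain ⟨Q, hQ, hQQ, hFQ⟩ := exists_projections_of_factor (hF j₀) hFF hF0 hfac
  have hex : ∀ i : {i // E i j₀}, ∃ p₀, (∀ p, p ≠ p₀ → B i.1 ⟨j₀, i.2⟩ p = 0) ∧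
      m.reducedState i.1 ⟨j₀, i.2⟩ = B i.1 ⟨j₀, i.2⟩ p₀ *
        diagonal (fun s => (v i.1 s : ℂ)) * (B i.1 ⟨j₀, i.2⟩ p₀)ᴴ := fun i => by
    have := (hS i.1).near
    rw [hnear i] at this
    exact this
  choose p₀ hp₀ hrho using hex
  let U : ∀ i : {i // E i j₀}, Matrix (Fin (m.dim i j₀)) (Fin (r i)) ℂ := fun i =>
    B i.1 ⟨j₀, i.2⟩ (p₀ i)
  have hcomp : ∀ X, compress (fun i : {i // E i j₀} => B i.1 ⟨j₀, i.2⟩) X =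
      (tensorMatrix U)ᴴ * X * tensorMatrix U := fun X => compress_of_single hp₀ X
  have hU : ∀ i, (U i)ᴴ * U i = 1 := fun i => by
    rw [← (hS i.1).isometry ⟨j₀, i.2⟩, Finset.sum_eq_single (p₀ i)
      (fun p _ hp => by rw [hp₀ i p hp, Matrix.mul_zero]) (fun h => absurd (Finset.mem_univ _) h)]
  refine ⟨fun i => r i, U, Q, fun i => isSupportBasis_of_eq (hS i.1).pos (hU i) (hrho i), hQ, hQQ,
    ?_, ?_⟩
  · rw [← hcomp, ← hFQ]
  · intro X Y hXY h
    rw [born_eq_sum_compress m.state hS, born_eq_sum_compress m.state hS]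
    refine Finset.sum_congr rfl fun d _ => congrArg _ (Finset.prod_congr rfl fun j _ => ?_)
    by_cases hj : j = j₀
    · subst hj
      rw [hcomp, hcomp, h]
    · rw [hXY j hj]

/-- An outcome must exist to absorb `1 - Q` in `exists_povm_of_sum_eq_projection`; without one the
conclusive effect would be zero. -/
theorem nonempty_of_pos (hpos : 0 < probAllConclusive m.prob) (j : Fin M) : Nonempty (O j) := by
  by_contra h
  rw [not_nonempty_iff] at h
  rw [m.probAllConclusive_eq, born_eq_zero m.state (j := j) (by simp [QuantumModel.conclusive])]
    at hpos
  simp at hpos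

variable {m}

theorem IsLocalProjection.isFairSamplingOnSupport {j : Fin M} [Nonempty (O j)]
    {r : {i // E i j} → ℕ} {U : ∀ i : {i // E i j}, Matrix (Fin (m.dim i j)) (Fin (r i)) ℂ}
    {Q : ∀ i : {i // E i j}, Matrix (Fin (r i)) (Fin (r i)) ℂ} (h : IsLocalProjection m j U Q) :
    m.IsFairSamplingOnSupport j := by
  intro r' V hV
  -- `W i` is the change of basis from the Schmidt basis `U i` to the given basis `V i` of the same
  -- support.
  let W : ∀ i : {i // E i j}, Matrix (Fin (r' i)) (Fin (r i)) ℂ := fun i => (V i)ᴴ * U i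
  have hVV : (tensorMatrix V)ᴴ * tensorMatrix V = 1 := by
    rw [conjTranspose_tensorMatrix, tensorMatrix_mul]
    simp only [(hV _).isometry, tensorMatrix_one]
  have hP : tensorMatrix V * (tensorMatrix V)ᴴ = tensorMatrix U * (tensorMatrix U)ᴴ := by
    simp only [conjTranspose_tensorMatrix, tensorMatrix_mul,
      ((hV _).mul_conjTranspose_eq (h.support _))]
  have hW : ∀ i, (W i)ᴴ * W i = 1 := fun i => by
    simp only [W, conjTranspose_mul, conjTranspose_conjTranspose]
    rw [Matrix.mul_assoc, ← Matrix.mul_assoc (V i), (h.support i).mul_conjTranspose_mul (hV i),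
      (h.support i).isometry]
  let K : ∀ i : {i // E i j}, Matrix (Fin (r' i)) (Fin (r' i)) ℂ := fun i => W i * Q i * (W i)ᴴ
  have hK : ∀ i, (K i).IsHermitian ∧ K i * K i = K i := fun i =>
    projection_conj (hW i) (h.isHermitian i) (h.mul_self i)
  have hcon : (tensorMatrix V)ᴴ * m.conclusive j * tensorMatrix V = tensorMatrix K := by
    calc _ = ((tensorMatrix V)ᴴ * tensorMatrix V) * (tensorMatrix V)ᴴ * m.conclusive j *
          tensorMatrix V * ((tensorMatrix V)ᴴ * tensorMatrix V) := by
            rw [hVV, Matrix.one_mul, Matrix.mul_one]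
      _ = (tensorMatrix V)ᴴ * (tensorMatrix V * (tensorMatrix V)ᴴ) * m.conclusive j *
          (tensorMatrix V * (tensorMatrix V)ᴴ) * tensorMatrix V := by simp only [Matrix.mul_assoc]
      _ = (tensorMatrix V)ᴴ * tensorMatrix U *
          ((tensorMatrix U)ᴴ * m.conclusive j * tensorMatrix U) *
          ((tensorMatrix U)ᴴ * tensorMatrix V) := by rw [hP]; simp only [Matrix.mul_assoc]
      _ = tensorMatrix K := by
        rw [h.conclusive_eq]
        simp only [conjTranspose_tensorMatrix, tensorMatrix_mul, K, W, conjTranspose_mul,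
          conjTranspose_conjTranspose]
  obtain ⟨G, hG, hGA⟩ := exists_povm_of_sum_eq_projection
    (A := fun a : O j => (tensorMatrix V)ᴴ * m.meas j (some a) * tensorMatrix V)
    (Q := tensorMatrix K)
    (fun a => ((m.isPOVM j).posSemidef _).conjTranspose_mul_mul_same _)
    (by rw [IsHermitian, conjTranspose_tensorMatrix]; simp only [(hK _).1.eq])
    (by rw [tensorMatrix_mul]; simp only [(hK _).2])
    (by rw [← Matrix.sum_mul, ← Matrix.mul_sum]; exact hcon)
  refine ⟨fun i => conjMap (K i), G, fun i => isFilter_conjMap (hK i).1 (hK i).2, hG, fun a => ?_, ?_⟩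
  · rw [tensorMap_conjMap, adjointMap_conjMap]
    exact hGA a
  · dsimp only
    rw [← Matrix.sum_mul, ← Matrix.mul_sum, m.meas_none, Matrix.mul_sub, Matrix.sub_mul,
      Matrix.mul_one, hVV]
    rfl

/-- A model of the post-selected distribution: the sources apply the local projections. -/
theorem postSelected_mem_quantumCorrelations (hpos : 0 < probAllConclusive m.prob)
    (h : ∀ j, ∃ (r : {i // E i j} → ℕ)
      (U : ∀ i : {i // E i j}, Matrix (Fin (m.dim i j)) (Fin (r i)) ℂ)
      (Q : ∀ i : {i // E i j}, Matrix (Fin (r i)) (Fin (r i)) ℂ), IsLocalProjection m j U Q) :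
    postSelected m.prob ∈ quantumCorrelations E O := by
  have := nonempty_of_pos m hpos
  choose r U Q hUQ using h
  let R : ∀ j (i : {i // E i j}), Matrix (Fin (m.dim i j)) (Fin (m.dim i j)) ℂ := fun j i =>
    U j i * Q j i * (U j i)ᴴ
  have hR : ∀ j i, (R j i).IsHermitian ∧ R j i * R j i = R j i := fun j i =>
    projection_conj ((hUQ j).support i).isometry ((hUQ j).isHermitian i) ((hUQ j).mul_self i)
  have hUU : ∀ j, (tensorMatrix (U j))ᴴ * tensorMatrix (U j) = 1 := fun j => by
    rw [conjTranspose_tensorMatrix, tensorMatrix_mul]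
    simp only [((hUQ j).support _).isometry, tensorMatrix_one]
  let A : ∀ j, Matrix (∀ i : {i // E i j}, Fin (m.dim i j)) (∀ i : {i // E i j}, Fin (m.dim i j)) ℂ →
      Matrix (∀ i : {i // E i j}, Fin (m.dim i j)) (∀ i : {i // E i j}, Fin (m.dim i j)) ℂ :=
    fun j X => (tensorMatrix (U j) * (tensorMatrix (U j))ᴴ)ᴴ * X *
      (tensorMatrix (U j) * (tensorMatrix (U j))ᴴ)
  have hAX : ∀ j X, A j X = tensorMatrix (U j) *
      ((tensorMatrix (U j))ᴴ * X * tensorMatrix (U j)) * (tensorMatrix (U j))ᴴ := fun j X => by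
    simp only [A, conjTranspose_mul, conjTranspose_conjTranspose, Matrix.mul_assoc]
  have hcomp : ∀ j X, (tensorMatrix (U j))ᴴ * A j X * tensorMatrix (U j) =
      (tensorMatrix (U j))ᴴ * X * tensorMatrix (U j) := fun j X => by
    rw [hAX]
    calc _ = ((tensorMatrix (U j))ᴴ * tensorMatrix (U j)) *
          ((tensorMatrix (U j))ᴴ * X * tensorMatrix (U j)) *
          ((tensorMatrix (U j))ᴴ * tensorMatrix (U j)) := by simp only [Matrix.mul_assoc]
      _ = _ := by rw [hUU, Matrix.one_mul, Matrix.mul_one]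
  -- The parties are replaced one at a time, since `born_congr` concerns a single party and rests on
  -- a purification adapted to it.
  have hborn : ∀ X, born m.state (fun j => A j (X j)) = born m.state X := by
    intro X
    have key : ∀ S : Finset (Fin M),
        born m.state (fun j => if j ∈ S then A j (X j) else X j) = born m.state X := by
      intro S
      induction S using Finset.induction_on with
      | empty => simp
      | insert j S hj ih =>
        rw [← ih]
        refine (hUQ j).born_congr _ _ (fun l hl => ?_) ?_
        · simp [hl]
        · simp only [Finset.mem_insert_self, if_true, hj, if_false, hcomp]
    simpa using key Finset.univ
  have hG : ∀ j, ∃ G : O j → Matrix _ _ ℂ, IsPOVM G ∧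
      ∀ a, A j (m.meas j (some a)) = (tensorMatrix (R j))ᴴ * G a * tensorMatrix (R j) := by
    intro j
    refine exists_povm_of_sum_eq_projection
      (fun a => ((m.isPOVM j).posSemidef _).conjTranspose_mul_mul_same _) ?_ ?_ ?_
    · rw [IsHermitian, conjTranspose_tensorMatrix]
      simp only [(hR j _).1.eq]
    · rw [tensorMatrix_mul]
      simp only [(hR j _).2]
    · have h1 : ∑ a, A j (m.meas j (some a)) = A j (m.conclusive j) := by
        simp only [A, ← Finset.sum_mul, ← Finset.mul_sum]
        rfl
      rw [h1, hAX, (hUQ j).conclusive_eq]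
      simp only [conjTranspose_tensorMatrix, tensorMatrix_mul, R]
  choose G hGpovm hGeq using hG
  let σ : ∀ i, Matrix (∀ j : {j // E i j}, Fin (m.dim i j)) (∀ j : {j // E i j}, Fin (m.dim i j)) ℂ :=
    fun i => (tensorMatrix fun j : {j // E i j} => R j.1 ⟨i, j.2⟩) * m.state i *
      (tensorMatrix fun j : {j // E i j} => R j.1 ⟨i, j.2⟩)ᴴ
  have hσ : ∀ i, (σ i).PosSemidef := fun i =>
    (m.isDensity i).posSemidef.mul_mul_conjTranspose_same _
  have hσG : ∀ a : (∀ j, O j),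
      born σ (fun j => G j (a j)) = born m.state (fun j => m.meas j (some (a j))) := by
    intro a
    rw [← hborn (fun j => m.meas j (some (a j)))]
    simp only [hGeq]
    exact born_conj m.state (fun i j => R j.1 ⟨i, j.2⟩) _
  -- Summing over all conclusive outcomes shows that the success probability is the product of the
  -- traces of the filtered states, so each source can be normalized separately.
  have htot : ∏ i, (σ i).trace = born m.state m.conclusive := by
    rw [← born_one σ]
    have h1 := sum_born σ G
    have h2 := sum_born m.state (fun j (a : O j) => m.meas j (some a))
    simp only [(hGpovm _).sum_eq_one] at h1
    rw [← h1]
    simp only [hσG]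
    exact h2
  have htr : ∀ i, (σ i).trace = ((σ i).trace.re : ℂ) := fun i =>
    (Complex.ext rfl (Complex.le_def.1 (hσ i).trace_nonneg).2.symm)
  have htotR : ∏ i, (σ i).trace.re = probAllConclusive m.prob := by
    rw [m.probAllConclusive_eq, ← htot, Finset.prod_congr rfl fun i _ => htr i,
      ← Complex.ofReal_prod, Complex.ofReal_re]
  have htpos : ∀ i, 0 < (σ i).trace.re := fun i => by
    refine lt_of_le_of_ne (Complex.le_def.1 (hσ i).trace_nonneg).1 fun h0 => ?_
    rw [← htotR, Finset.prod_eq_zero (Finset.mem_univ i) h0.symm] at hpos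
    exact lt_irrefl _ hpos
  refine ⟨⟨m.dim, fun i => (((σ i).trace.re⁻¹ : ℝ) : ℂ) • σ i, G, fun i => ⟨?_, ?_⟩, hGpovm⟩, ?_⟩
  · refine (hσ i).smul ?_
    exact_mod_cast (inv_pos.2 (htpos i)).le
  · rw [Matrix.trace_smul, smul_eq_mul, htr i, Complex.ofReal_re, ← Complex.ofReal_mul,
      inv_mul_cancel₀ (htpos i).ne', Complex.ofReal_one]
  · funext a
    rw [QuantumModel.prob_eq_born, postSelected, m.prob_eq_born]
    dsimp only
    rw [born_smul, hσG, ← Complex.ofReal_prod, Complex.re_ofReal_mul, Finset.prod_inv_distrib,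
      htotR, div_eq_inv_mul]

end Party

end QNet

end

theorem corollary4 {N M : ℕ} (E : Fin N → Fin M → Bool)
    (hbip : QNet.IsBipartite E) (hred : QNet.NoRedundantSource E)
    (O : Fin M → Type*) [∀ j, Fintype (O j)]
    (m : QNet.QuantumModel E (fun j => Option (O j)))
    (hpos : 0 < QNet.probAllConclusive m.prob)
    (hsat : QNet.SaturatesFinner m.prob) :
    (∀ j, m.IsFairSamplingOnSupport j) ∧
      QNet.postSelected m.prob ∈ QNet.quantumCorrelations E O := by
  have h := QNet.exists_isLocalProjection m hbip hred hpos hsat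
  refine ⟨fun j => ?_, QNet.postSelected_mem_quantumCorrelations hpos h⟩
  have := QNet.nonempty_of_pos m hpos j
  obtain ⟨r, U, Q, hUQ⟩ := h j
  exact hUQ.isFairSamplingOnSupport
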